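/- Setting. Let $n\ge 2$ and $p$ be integers, and let $\mathcal G$ be a connected weighted undirected graph on $\{1,\dots,n\}$ with symmetric weighted adjacency matrix $A=(a_{ij})$, $a_{ij}\ge 0$, $a_{ii}=0$ ($i$ and $j$ are linked iff $a_{ij}>0$). Let $L=\operatorname{diag}(\sum_j a_{ij})-A$ be its Laplacian, $\rho(L)$ its spectral radius and $\rho_2(L)$ its smallest positive eigenvalue. Let $f_1,\dots,f_n:\mathbb R^p\to\mathbb R$ be differentiable with $\|\nabla f_i(x)-\nabla f_i(y)\|\le L_f\|x-y\|$ for all $x,y$, where $L_f>0$. Let $f=\frac1n\sum_{i=1}^n f_i$, assume that the set $\mathbb X^*$ of global minimizers of $f$ is nonempty, and let $f^*=\min f$. Algorithm. Given $\alpha,\beta,\eta$, arbitrary $x_{i,0}\in\mathbb R^p$, and $v_{i,0}\in\mathbb R^p$ with $\sum_{j=1}^n v_{j,0}=0$ (e.g. $v_{i,0}=0$), let, for $k\ge 0$ and $i=1,\dots,n$, $$x_{i,k+1}=x_{i,k}-\eta\Big(\alpha\sum_{j=1}^nL_{ij}x_{j,k}+\beta v_{i,k}+\nabla f_i(x_{i,k})\Big),\qquad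 v_{i,k+1}=v_{i,k}+\eta\beta\sum_{j=1}^nL_{ij}x_{j,k}.$$ Write $\boldsymbol x_k=(x_{1,k},\dots,x_{n,k})\in\mathbb R^{np}$, $\boldsymbol v_k=(v_{1,k},\dots,v_{n,k})$, $\bar x_k=\frac1n\sum_i x_{i,k}$, $\bar{\boldsymbol x}_k=\mathbf 1_n\otimes\bar x_k$, $\boldsymbol g^0_0=(\nabla f_1(\bar x_0),\dots,\nabla f_n(\bar x_0))$, $\|\boldsymbol z\|_{\boldsymbol K}^2=\boldsymbol z^\top\boldsymbol K\boldsymbol z$ with $\boldsymbol K=(\mathbf I_n-\frac1n\mathbf 1_n\mathbf 1_n^\top)\otimes\mathbf I_p$, and $$\hat V_0=\|\boldsymbol x_0\|_{\boldsymbol K}^2+\big\|\boldsymbol v_0+\tfrac1\beta\boldsymbol g_0^0\big\|_{\boldsymbol K}^2+n(f(\bar x_0)-f^*).$$ Parameters. Let $\kappa_2>1$, $\beta>\max\{\frac{\kappa_1}{\kappa_2-1},\kappa_3,\kappa_4\}$, $\alpha\in(\beta+\kappa_1,\kappa_2\beta]$ and $0<\eta<\min\{\frac{\epsilon_1}{\epsilon_2},\frac{\epsilon_3}{\epsilon_4},\frac{\epsilon_5}{\epsilon_6}\}$,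 where $$\kappa_1=\tfrac{2+3L_f^2}{2\rho_2(L)},\quad \kappa_3=\tfrac14\Big(1+\big(1+8\kappa_2+\tfrac{8}{\rho_2(L)}\big)^{1/2}\Big),\quad \kappa_4=\big(\kappa_2+\tfrac1{\rho_2(L)}\big)L_f^2+\Big(\big(\kappa_2+\tfrac1{\rho_2(L)}\big)^2L_f^2+2\Big)^{1/2}L_f,$$ $$\epsilon_1=(\alpha-\beta)\rho_2(L)-\tfrac12(2+3L_f^2),\quad \epsilon_2=\beta^2\rho(L)+(2\alpha^2+\beta^2)\rho(L)^2+\tfrac52L_f^2,$$ $$\epsilon_3=\beta-\tfrac12-\tfrac{\alpha}{2\beta^2}-\tfrac1{2\beta\rho_2(L)},\quad \epsilon_4=2\beta^2+\tfrac12,$$ $$\epsilon_5=\tfrac14-\tfrac1{2\beta}\Big(\tfrac1\beta+\tfrac1{\rho_2(L)}+\tfrac\alpha\beta\Big)L_f^2,\quad \epsilon_6=\tfrac1{\beta^2}\Big(1+\tfrac1{\rho_2(L)}+\tfrac\alpha\beta\Big)L_f^2+\tfrac{L_f(1+L_f)}2.$$ Theorem. Suppose that, in addition, $f$ satisfies the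 Polyak–Łojasiewicz condition with a constant $\nu>0$, that is, $\frac12\|\nabla f(x)\|^2\ge\nu(f(x)-f^*)$ for all $x\in\mathbb R^p$. (The parameters above do not depend on $\nu$.) Put $$\epsilon_8=\tfrac{\alpha+\beta}{2\beta}+\tfrac1{2\rho_2(L)},\quad \epsilon_9=\min\Big\{\tfrac1{2\rho(L)},\tfrac{\alpha-\beta}{2\alpha}\Big\},\quad \epsilon_{10}=\eta\min\big\{\epsilon_1-\eta\epsilon_2,\ \epsilon_3-\eta\epsilon_4,\ \tfrac\nu2\big\},$$ $\epsilon=\epsilon_{10}/\epsilon_8$ and $c=\epsilon_8\hat V_0/\epsilon_9$. Then $0<\epsilon<1$ and $$\|\boldsymbol x_k-\bar{\boldsymbol x}_k\|^2+n(f(\bar x_k)-f^*)\le(1-\epsilon)^kc\qquad\text{for all }k\ge 0.$$ Moreover, if the projection $\mathcal P_{\mathbb X^*}$ onto $\mathbb X^*$ is well defined (every $x\in\mathbb R^p$ has a unique nearest point $\mathcal P_{\mathbb X^*}(x)$ in $\mathbb X^*$), then $$\|\boldsymbol x_k-\mathbf 1_n\otimes\mathcal P_{\mathbb X^*}(\bar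 x_k)\|^2\le(1-\epsilon)^kc\Big(1+\frac1{2\nu}\Big)\qquad\text{for all }k\ge 0.$$ -/

import Mathlib

noncomputable section

namespace DistOpt

/-! ### Weighted undirected graphs -/

/-- A weighted undirected graph on the vertex set `{1, …, n}`, given by its symmetric weighted
adjacency matrix with nonnegative entries and zero diagonal. -/
structure WeightedGraph (n : ℕ) where
  /-- the weighted adjacency matrix `A = (a_ij)` -/
  A : Matrix (Fin n) (Fin n) ℝ
  symm : A.transpose = A
  nonneg : ∀ i j, 0 ≤ A i j
  diag_zero : ∀ i, A i i = 0

namespace WeightedGraph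

variable {n : ℕ}

/-- The underlying simple graph: `i` and `j` are adjacent iff `a_ij > 0`. -/
def toSimpleGraph (G : WeightedGraph n) : SimpleGraph (Fin n) where
  Adj i j := 0 < G.A i j
  symm := ⟨fun i j h => by
    have hs : G.A j i = G.A i j := congrFun (congrFun G.symm i) j
    rw [hs]; exact h⟩
  loopless := ⟨fun i h => by rw [G.diag_zero i] at h; exact lt_irrefl _ h⟩

/-- The graph is connected. -/
def Connected (G : WeightedGraph n) : Prop := G.toSimpleGraph.Connected

/-- The weighted degree of a vertex. -/
def deg (G : WeightedGraph n) (i : Fin n) : ℝ := ∑ j, G.A i j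

/-- The Laplacian matrix `L = Deg - A`. -/
def laplacian (G : WeightedGraph n) : Matrix (Fin n) (Fin n) ℝ :=
  Matrix.diagonal G.deg - G.A

/-- The spectral radius `ρ(L)` of the Laplacian (a real symmetric matrix, so all of its
eigenvalues are real). -/
def rho (G : WeightedGraph n) : ℝ := (spectralRadius ℝ G.laplacian).toReal

/-- `ρ₂(L)`, the smallest positive eigenvalue of the Laplacian (it exists as soon as `L` has a
positive eigenvalue, in particular for a connected graph with at least two vertices). -/
def rho2 (G : WeightedGraph n) : ℝ := sInf {t : ℝ | t ∈ spectrum ℝ G.laplacian ∧ 0 < t}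

end WeightedGraph

/-! ### Functions on `ℝ^p` -/

/-- `ℝ^p` with the Euclidean norm. -/
abbrev Vec (p : ℕ) : Type := EuclideanSpace ℝ (Fin p)

/-- `f` is smooth with constant `Lf > 0`: it is differentiable with `Lf`-Lipschitz gradient. -/
def SmoothWith {p : ℕ} (f : Vec p → ℝ) (Lf : ℝ) : Prop :=
  0 < Lf ∧ Differentiable ℝ f ∧ ∀ x y, ‖gradient f x - gradient f y‖ ≤ Lf * ‖x - y‖

/-- The set of global minimizers of `f`. -/
def optimalSet {p : ℕ} (f : Vec p → ℝ) : Set (Vec p) := {x | ∀ y, f x ≤ f y}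

/-- The optimal value of `f` (the minimum of `f` whenever a global minimizer exists). -/
def optimalValue {p : ℕ} (f : Vec p → ℝ) : ℝ := ⨅ x, f x

/-- The Polyak--Łojasiewicz condition with constant `ν > 0`. -/
def PolyakLojasiewicz {p : ℕ} (f : Vec p → ℝ) (ν : ℝ) : Prop :=
  0 < ν ∧ ∀ x, ν * (f x - optimalValue f) ≤ 1 / 2 * ‖gradient f x‖ ^ 2

/-- `argmin_{y ∈ S} ‖x - y‖²`. -/
def nearestPoints {p : ℕ} (S : Set (Vec p)) (x : Vec p) : Set (Vec p) :=
  {y | y ∈ S ∧ ∀ z ∈ S, ‖x - y‖ ^ 2 ≤ ‖x - z‖ ^ 2}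

/-- `P` is the projection operator onto `S`: for every `x`, the point `P x` is the unique nearest
point of `S` to `x`. The projection onto `S` is well defined iff such a `P` exists. -/
def IsProjectionOnto {p : ℕ} (S : Set (Vec p)) (P : Vec p → Vec p) : Prop :=
  ∀ x, nearestPoints S x = {P x}

/-! ### Stacked vectors -/

/-- `ℝ^{np}`, written as `n` blocks in `ℝ^p`, with the Euclidean norm of `ℝ^{np}`. -/
abbrev Stacked (n p : ℕ) : Type := PiLp 2 (fun _ : Fin n => Vec p)

/-- `1_n ⊗ y`. -/
def consensus (n : ℕ) {p : ℕ} (y : Vec p) : Stacked n p := WithLp.toLp 2 (fun _ => y)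

/-- The average `(1/n) ∑ x_i` of the blocks. -/
def average {n p : ℕ} (x : Stacked n p) : Vec p := (1 / (n : ℝ)) • ∑ i, x i

/-- `‖z‖²_{M ⊗ I_p} = zᵀ (M ⊗ I_p) z`. -/
def blockForm {n p : ℕ} (M : Matrix (Fin n) (Fin n) ℝ) (z : Stacked n p) : ℝ :=
  ∑ i, ∑ j, M i j * inner ℝ (z i) (z j)

/-- `K_n = I_n - (1/n) 1_n 1_nᵀ`. -/
def centering (n : ℕ) : Matrix (Fin n) (Fin n) ℝ :=
  1 - (1 / (n : ℝ)) • Matrix.of (fun _ _ => 1)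

/-! ### The problem and the algorithm -/

/-- The global cost `f(x) = (1/n) ∑ f_i(x)`. -/
def globalCost {n p : ℕ} (f : Fin n → Vec p → ℝ) (x : Vec p) : ℝ :=
  (1 / (n : ℝ)) * ∑ i, f i x

/-- The gradient of `(x_1, …, x_n) ↦ ∑ f_i(x_i)`, that is, `col(∇f_1(x_1), …, ∇f_n(x_n))`. -/
def stackedGradient {n p : ℕ} (f : Fin n → Vec p → ℝ) (x : Stacked n p) : Stacked n p :=
  WithLp.toLp 2 (fun i => gradient (f i) (x i))

/-- `(x_k, v_k)` is generated by the distributed first-order primal--dual algorithm with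
parameters `α, β, η`: the starting point `x_0` is arbitrary, the `v_{i,0}` sum to zero
(for instance `v_{i,0} = 0`). -/
structure IsPrimalDualRun {n p : ℕ} (G : WeightedGraph n) (f : Fin n → Vec p → ℝ)
    (α β η : ℝ) (x v : ℕ → Stacked n p) : Prop where
  init : ∑ i, v 0 i = 0
  step_x : ∀ k i, x (k + 1) i = x k i -
    η • (α • (∑ j, G.laplacian i j • x k j) + β • v k i + gradient (f i) (x k i))
  step_v : ∀ k i, v (k + 1) i = v k i + (η * β) • ∑ j, G.laplacian i j • x k j

/-- `V̂ = ‖x‖²_K + ‖v + g⁰/β‖²_K + n (f(x̄) - f*)` with `g⁰ = ∇f̃(1_n ⊗ x̄)`. -/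
def lyapHat {n p : ℕ} (f : Fin n → Vec p → ℝ) (β : ℝ) (x v : Stacked n p) : ℝ :=
  blockForm (centering n) x +
    blockForm (centering n) (v + (1 / β) • stackedGradient f (consensus n (average x))) +
    n * (globalCost f (average x) - optimalValue (globalCost f))

/-! ### The constants -/

section Constants

variable {n : ℕ} (G : WeightedGraph n)

def kappa1 (Lf : ℝ) : ℝ := 1 / (2 * G.rho2) * (2 + 3 * Lf ^ 2)

def kappa3 (κ₂ : ℝ) : ℝ := 1 / 4 * (1 + Real.sqrt (1 + 8 * κ₂ + 8 / G.rho2))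

def kappa4 (Lf κ₂ : ℝ) : ℝ :=
  (κ₂ + 1 / G.rho2) * Lf ^ 2 + Real.sqrt ((κ₂ + 1 / G.rho2) ^ 2 * Lf ^ 2 + 2) * Lf

def eps1 (Lf α β : ℝ) : ℝ := (α - β) * G.rho2 - 1 / 2 * (2 + 3 * Lf ^ 2)

def eps2 (Lf α β : ℝ) : ℝ :=
  β ^ 2 * G.rho + (2 * α ^ 2 + β ^ 2) * G.rho ^ 2 + 5 / 2 * Lf ^ 2

def eps3 (α β : ℝ) : ℝ := β - 1 / 2 - α / (2 * β ^ 2) - 1 / (2 * β * G.rho2)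

def eps4 (β : ℝ) : ℝ := 2 * β ^ 2 + 1 / 2

def eps5 (Lf α β : ℝ) : ℝ :=
  1 / 4 - 1 / (2 * β) * (1 / β + 1 / G.rho2 + α / β) * Lf ^ 2

def eps6 (Lf α β : ℝ) : ℝ :=
  1 / β ^ 2 * (1 + 1 / G.rho2 + α / β) * Lf ^ 2 + Lf * (1 + Lf) / 2

def eps8 (α β : ℝ) : ℝ := (α + β) / (2 * β) + 1 / (2 * G.rho2)

def eps9 (α β : ℝ) : ℝ := min (1 / (2 * G.rho)) ((α - β) / (2 * α))

def eps10 (Lf α β η ν : ℝ) : ℝ :=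
  η * min (min (eps1 G Lf α β - η * eps2 G Lf α β) (eps3 G α β - η * eps4 β)) (ν / 2)

/-- The rate `ε = ε₁₀ / ε₈`. -/
def rate (Lf α β η ν : ℝ) : ℝ := eps10 G Lf α β η ν / eps8 G α β

/-- The admissible algorithm parameters; they do not involve the constant `ν`. -/
structure Admissible (Lf κ₂ α β η : ℝ) : Prop where
  kappa2_gt : 1 < κ₂
  beta_gt : max (max (kappa1 G Lf / (κ₂ - 1)) (kappa3 G κ₂)) (kappa4 G Lf κ₂) < β
  alpha_mem : α ∈ Set.Ioc (β + kappa1 G Lf) (κ₂ * β)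
  eta_mem : η ∈ Set.Ioo 0 (min (min (eps1 G Lf α β / eps2 G Lf α β)
    (eps3 G α β / eps4 β)) (eps5 G Lf α β / eps6 G Lf α β))

end Constants

/-- The constant `c = ε₈ V̂_0 / ε₉`. -/
def initConst {n p : ℕ} (G : WeightedGraph n) (f : Fin n → Vec p → ℝ) (α β : ℝ)
    (x₀ v₀ : Stacked n p) : ℝ :=
  eps8 G α β * lyapHat f β x₀ v₀ / eps9 G α β

end DistOpt

end

/-!
The Laplacian `L` is symmetric, so everything is written in an orthonormal eigenbasis of `L`
(`WeightedGraph.mode`). On a connected graph the modes with nonzero eigenvalue carry exactly the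
deviation of the blocks from their average (`WeightedGraph.sum_posModes`), and their eigenvalues lie
between `ρ₂(L)` and `ρ(L)`. No pseudoinverse of `L` is needed: it acts as `1 / l` on a mode with
eigenvalue `l`.

Put `w = v + g⁰ / β`, where `g⁰` collects the local gradients at the average. Up to the gradient
error due to disagreement and the increment of `g⁰`, each mode follows
`x ↦ x - η (α l x + β w)`, `w ↦ w + η β l x`, and the first-order cross terms cancel in the energy
`‖x‖² / 2 + (1 / l + α / β) ‖w‖² / 2 + ⟪x, w⟫`. Young's inequality in each mode
(`modeEnergy_step_le`), summed over the modes, gives the decrease of the total energy `E`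
(`IsPrimalDualRun.energy_step_le`). The average performs an inexact gradient step, so the descent
lemma controls `F = n (f(x̄) - f*)` (`IsPrimalDualRun.subopt_step_le`), and the
Polyak–Łojasiewicz condition turns the squared gradient into `F`. Together,
`E + F` contracts by `1 - ε` (`IsPrimalDualRun.lyapunov_step`), which with
`ε₉ (‖x‖²_K + ‖w‖²_K) ≤ E ≤ ε₈ (‖x‖²_K + ‖w‖²_K)` gives the first estimate.

For the second estimate, quadratic growth (`PolyakLojasiewicz.quadratic_growth`) bounds the squared
distance of `x̄` to the minimizers, times `n`, by `(2 / ν) F`, and this constant is sharp. The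
factor `1 + 1 / (2 ν)` follows once `F ≤ (1 - ε)^k c / 4`. If `ε₉ ≤ 1 / 4`, this is contained in the
decay of `E + F`, because `F` enters it with weight `1` and not `ε₉`. If `ε₉ > 1 / 4`, then
`α > 2 β` and `ρ(L) < 2`; in this regime Young's inequality leaves enough room for the same
contraction of `E + 2 F` (`IsPrimalDualRun.lyapunov_two_step`), and `4 ε₉ ≤ ε₈` closes the gap.
-/

namespace DistOpt

/-! ### The Laplacian in its eigenbasis -/

namespace WeightedGraph

variable {n : ℕ} {E : Type*} [NormedAddCommGroup E] [InnerProductSpace ℝ E]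

theorem isHermitian_laplacian (G : WeightedGraph n) : G.laplacian.IsHermitian := by
  have h1 : (Matrix.diagonal G.deg).IsHermitian := Matrix.isHermitian_diagonal _
  have h2 : G.A.IsHermitian := by
    rw [Matrix.IsHermitian, Matrix.conjTranspose_eq_transpose_of_trivial, G.symm]
  exact h1.sub h2

/-- The eigenvalues of the Laplacian, with multiplicity. -/
noncomputable def eig (G : WeightedGraph n) (a : Fin n) : ℝ := G.isHermitian_laplacian.eigenvalues a

/-- An orthonormal basis of eigenvectors of the Laplacian: `G.eigVec a i` is the `i`-th entry of
the eigenvector that belongs to `G.eig a`. -/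
noncomputable def eigVec (G : WeightedGraph n) (a i : Fin n) : ℝ :=
  G.isHermitian_laplacian.eigenvectorBasis a i

/-- The coordinate of a family of `n` vectors along the `a`-th eigenvector of the Laplacian. -/
noncomputable def mode (G : WeightedGraph n) (a : Fin n) (z : Fin n → E) : E :=
  ∑ i, G.eigVec a i • z i

theorem sum_eigVec_mul (G : WeightedGraph n) (i j : Fin n) :
    ∑ a, G.eigVec a i * G.eigVec a j = if i = j then 1 else 0 := by
  have h := Matrix.mem_unitaryGroup_iff.mp G.isHermitian_laplacian.eigenvectorUnitary.2
  have h' := congrFun (congrFun h i) j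
  rw [Matrix.mul_apply, Matrix.one_apply] at h'
  simpa [Matrix.star_apply, eigVec] using h'

theorem sum_laplacian_mul_eigVec (G : WeightedGraph n) (a i : Fin n) :
    ∑ j, G.laplacian i j * G.eigVec a j = G.eig a * G.eigVec a i := by
  have h := congrFun (G.isHermitian_laplacian.mulVec_eigenvectorBasis a) i
  simpa [Matrix.mulVec, dotProduct, eigVec, eig] using h

theorem laplacian_symm (G : WeightedGraph n) (i j : Fin n) :
    G.laplacian i j = G.laplacian j i := by
  simpa using (G.isHermitian_laplacian.apply j i)

theorem sum_laplacian (G : WeightedGraph n) (i : Fin n) : ∑ j, G.laplacian i j = 0 := by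
  simp [laplacian, Matrix.diagonal_apply, deg]

/-- Parseval's identity. -/
theorem sum_norm_sq_mode (G : WeightedGraph n) (z : Fin n → E) :
    ∑ a, ‖G.mode a z‖ ^ 2 = ∑ i, ‖z i‖ ^ 2 := by
  have h : ∀ a, ‖G.mode a z‖ ^ 2 =
      ∑ i, ∑ j, (G.eigVec a i * G.eigVec a j) * inner ℝ (z i) (z j) := by
    intro a
    rw [← real_inner_self_eq_norm_sq, mode, sum_inner]
    refine Finset.sum_congr rfl fun i _ => ?_
    rw [inner_sum]
    refine Finset.sum_congr rfl fun j _ => ?_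
    rw [real_inner_smul_left, real_inner_smul_right]; ring
  simp_rw [h]
  rw [Finset.sum_comm]
  refine Finset.sum_congr rfl fun i _ => ?_
  rw [Finset.sum_comm]
  simp_rw [← Finset.sum_mul, sum_eigVec_mul]
  simp

theorem mode_add (G : WeightedGraph n) (a : Fin n) (y z : Fin n → E) :
    G.mode a (fun i => y i + z i) = G.mode a y + G.mode a z := by
  simp [mode, Finset.sum_add_distrib]

theorem mode_smul (G : WeightedGraph n) (a : Fin n) (c : ℝ) (z : Fin n → E) :
    G.mode a (fun i => c • z i) = c • G.mode a z := by
  simp only [mode, Finset.smul_sum]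
  exact Finset.sum_congr rfl fun i _ => smul_comm _ _ _

theorem mode_sub (G : WeightedGraph n) (a : Fin n) (y z : Fin n → E) :
    G.mode a (fun i => y i - z i) = G.mode a y - G.mode a z := by
  simp [mode, Finset.sum_sub_distrib, smul_sub]

/-- In the eigenbasis the Laplacian acts diagonally. -/
theorem mode_laplacian (G : WeightedGraph n) (a : Fin n) (z : Fin n → E) :
    G.mode a (fun i => ∑ j, G.laplacian i j • z j) = G.eig a • G.mode a z := by
  simp only [mode, Finset.smul_sum, smul_smul]
  rw [Finset.sum_comm]
  refine Finset.sum_congr rfl fun j _ => ?_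
  rw [← Finset.sum_smul, ← sum_laplacian_mul_eigVec]
  congr 1
  exact Finset.sum_congr rfl fun i _ => by rw [G.laplacian_symm j i, mul_comm]

/-- The quadratic form of the Laplacian is the weighted sum of the squared differences. -/
theorem sum_mul_laplacian_mul (G : WeightedGraph n) (u : Fin n → ℝ) :
    ∑ i, u i * ∑ j, G.laplacian i j * u j = 1 / 2 * ∑ i, ∑ j, G.A i j * (u i - u j) ^ 2 := by
  have hs : ∀ i j, G.A i j = G.A j i := fun i j => congrFun (congrFun G.symm j) i
  have h1 : ∀ i, ∑ j, G.laplacian i j * u j = ∑ j, G.A i j * (u i - u j) := by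
    intro i
    simp only [laplacian, Matrix.sub_apply, Matrix.diagonal_apply, sub_mul, ite_mul, zero_mul,
      Finset.sum_sub_distrib, Finset.sum_ite_eq, Finset.mem_univ, if_true, deg, mul_sub,
      Finset.sum_mul]
  have h2 : ∑ i, ∑ j, G.A i j * (u i * (u i - u j)) =
      ∑ i, ∑ j, G.A i j * (u j * (u j - u i)) := by
    rw [Finset.sum_comm]
    exact Finset.sum_congr rfl fun i _ => Finset.sum_congr rfl fun j _ => by rw [hs]
  have h3 : ∑ i, ∑ j, G.A i j * (u i - u j) ^ 2 =
      ∑ i, ∑ j, G.A i j * (u i * (u i - u j)) + ∑ i, ∑ j, G.A i j * (u j * (u j - u i)) := by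
    simp only [← Finset.sum_add_distrib]
    exact Finset.sum_congr rfl fun i _ => Finset.sum_congr rfl fun j _ => by ring
  have h4 : ∑ i, u i * ∑ j, G.laplacian i j * u j = ∑ i, ∑ j, G.A i j * (u i * (u i - u j)) := by
    refine Finset.sum_congr rfl fun i _ => ?_
    rw [h1, Finset.mul_sum]
    exact Finset.sum_congr rfl fun j _ => by ring
  rw [h3, ← h2, h4]
  ring

theorem eig_eq_sum (G : WeightedGraph n) (a : Fin n) :
    G.eig a = 1 / 2 * ∑ i, ∑ j, G.A i j * (G.eigVec a i - G.eigVec a j) ^ 2 := by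
  rw [← sum_mul_laplacian_mul]
  simp_rw [sum_laplacian_mul_eigVec]
  have h : ∑ i, G.eigVec a i ^ 2 = 1 := by
    have h := G.isHermitian_laplacian.eigenvectorBasis.norm_eq_one a
    have h' := EuclideanSpace.real_norm_sq_eq (G.isHermitian_laplacian.eigenvectorBasis a)
    rw [h] at h'
    simpa [eigVec] using h'.symm
  calc G.eig a = G.eig a * ∑ i, G.eigVec a i ^ 2 := by rw [h, mul_one]
    _ = _ := by
      rw [Finset.mul_sum]; exact Finset.sum_congr rfl fun i _ => by ring

theorem eig_nonneg (G : WeightedGraph n) (a : Fin n) : 0 ≤ G.eig a := by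
  rw [eig_eq_sum]
  exact mul_nonneg (by norm_num) (Finset.sum_nonneg fun i _ => Finset.sum_nonneg fun j _ =>
    mul_nonneg (G.nonneg i j) (sq_nonneg _))

/-- On a connected graph, the eigenvectors for the eigenvalue zero are constant. -/
theorem eigVec_eq_of_eig_eq_zero (G : WeightedGraph n) (hG : G.Connected) {a : Fin n}
    (ha : G.eig a = 0) (i j : Fin n) : G.eigVec a i = G.eigVec a j := by
  have hadj : ∀ k l, G.toSimpleGraph.Adj k l → G.eigVec a k = G.eigVec a l := by
    intro k l hkl
    have h0 := G.eig_eq_sum a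
    rw [ha] at h0
    have hn : ∀ i j, 0 ≤ G.A i j * (G.eigVec a i - G.eigVec a j) ^ 2 := fun i j =>
      mul_nonneg (G.nonneg i j) (sq_nonneg _)
    have h1 : ∑ i, ∑ j, G.A i j * (G.eigVec a i - G.eigVec a j) ^ 2 = 0 := by linarith
    have h2 := (Finset.sum_eq_zero_iff_of_nonneg
      (fun i _ => Finset.sum_nonneg fun j _ => hn i j)).mp h1 k (Finset.mem_univ _)
    have h3 := (Finset.sum_eq_zero_iff_of_nonneg (fun j _ => hn k j)).mp h2 l (Finset.mem_univ _)
    have hkl' : 0 < G.A k l := hkl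
    have h4 := (mul_eq_zero.mp h3).resolve_left hkl'.ne'
    exact sub_eq_zero.mp (pow_eq_zero_iff (two_ne_zero)|>.mp h4)
  obtain ⟨w⟩ := hG.preconnected i j
  induction w with
  | nil => rfl
  | cons h _ ih => exact (hadj _ _ h).trans ih

theorem sum_eigVec_of_eig_ne_zero (G : WeightedGraph n) {a : Fin n} (ha : G.eig a ≠ 0) :
    ∑ i, G.eigVec a i = 0 := by
  have h : G.eig a * ∑ i, G.eigVec a i = 0 := by
    rw [Finset.mul_sum]
    simp_rw [← sum_laplacian_mul_eigVec]
    rw [Finset.sum_comm]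
    refine Finset.sum_eq_zero fun j _ => ?_
    rw [← Finset.sum_mul]
    simp_rw [fun i => G.laplacian_symm i j]
    rw [sum_laplacian, zero_mul]
  exact (mul_eq_zero.mp h).resolve_left ha

/-- The indices of the eigenvectors with a nonzero eigenvalue. On a connected graph these
eigenvectors span the orthogonal complement of the consensus vectors. -/
noncomputable def posModes (G : WeightedGraph n) : Finset (Fin n) :=
  Finset.univ.filter fun a => G.eig a ≠ 0

theorem mem_posModes {G : WeightedGraph n} {a : Fin n} : a ∈ G.posModes ↔ G.eig a ≠ 0 := by
  simp [posModes]

/-- Bessel's inequality for the nonzero modes. -/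
theorem sum_posModes_le (G : WeightedGraph n) (z : Fin n → E) :
    ∑ a ∈ G.posModes, ‖G.mode a z‖ ^ 2 ≤ ∑ i, ‖z i‖ ^ 2 := by
  rw [← G.sum_norm_sq_mode z]
  exact Finset.sum_le_univ_sum_of_nonneg fun a => sq_nonneg _

/-- The nonzero modes carry exactly the deviation from the average. -/
theorem sum_posModes (G : WeightedGraph n) (hG : G.Connected) (hn : n ≠ 0) (z : Fin n → E) :
    ∑ a ∈ G.posModes, ‖G.mode a z‖ ^ 2 = ∑ i, ‖z i - (1 / (n : ℝ)) • ∑ j, z j‖ ^ 2 := by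
  rw [← G.sum_norm_sq_mode]
  have hn' : (n : ℝ) ≠ 0 := Nat.cast_ne_zero.mpr hn
  have h1 : ∀ a, G.mode a (fun i => z i - (1 / (n : ℝ)) • ∑ j, z j) =
      if a ∈ G.posModes then G.mode a z else 0 := by
    intro a
    split_ifs with ha
    · rw [mem_posModes] at ha
      rw [mode_sub]
      simp only [mode, ← Finset.sum_smul, G.sum_eigVec_of_eig_ne_zero ha, zero_smul, sub_zero]
    · rw [mem_posModes, not_not] at ha
      have i₀ : Fin n := a
      simp only [mode, fun i => G.eigVec_eq_of_eig_eq_zero hG ha i i₀]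
      rw [← Finset.smul_sum, Finset.sum_sub_distrib]
      simp only [Finset.sum_const, Finset.card_univ, Fintype.card_fin, ← Nat.cast_smul_eq_nsmul ℝ,
        smul_smul]
      rw [mul_one_div_cancel hn', one_smul, sub_self, smul_zero]
  simp only [h1]
  rw [← Finset.sum_subset (Finset.subset_univ G.posModes)]
  · exact Finset.sum_congr rfl fun a ha => by rw [if_pos ha]
  · intro a _ ha; simp [ha]

theorem eig_le_rho (G : WeightedGraph n) (a : Fin n) : G.eig a ≤ G.rho := by
  have hspec := G.isHermitian_laplacian.spectrum_real_eq_range_eigenvalues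
  have hmem : G.eig a ∈ spectrum ℝ G.laplacian := by rw [hspec]; exact ⟨a, rfl⟩
  have hfin : spectralRadius ℝ G.laplacian ≠ ⊤ := by
    have hle : spectralRadius ℝ G.laplacian ≤ ∑ b, (‖G.eig b‖₊ : ENNReal) := by
      refine iSup₂_le fun k hk => ?_
      rw [hspec] at hk
      obtain ⟨b, rfl⟩ := hk
      exact Finset.single_le_sum (f := fun b => (‖G.eig b‖₊ : ENNReal))
        (fun _ _ => zero_le) (Finset.mem_univ b)
    exact ne_top_of_le_ne_top (ENNReal.sum_ne_top.mpr fun _ _ => ENNReal.coe_ne_top) hle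
  have h : (‖G.eig a‖₊ : ENNReal) ≤ spectralRadius ℝ G.laplacian :=
    le_iSup₂ (f := fun k (_ : k ∈ spectrum ℝ G.laplacian) => (‖k‖₊ : ENNReal)) _ hmem
  have h2 := ENNReal.toReal_mono hfin h
  calc G.eig a ≤ ‖G.eig a‖ := Real.le_norm_self _
    _ = (‖G.eig a‖₊ : ENNReal).toReal := by simp
    _ ≤ G.rho := h2

theorem posModes_nonempty (G : WeightedGraph n) (hG : G.Connected) (hn : 2 ≤ n) :
    G.posModes.Nonempty := by
  by_contra hne
  rw [Finset.not_nonempty_iff_eq_empty] at hne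
  -- Without nonzero modes every family would be constant; the indicator of one vertex is not.
  let i₀ : Fin n := ⟨0, by omega⟩
  let i₁ : Fin n := ⟨1, by omega⟩
  have h := G.sum_posModes hG (by omega) (fun i => if i = i₀ then (1 : ℝ) else 0)
  rw [hne, Finset.sum_empty] at h
  have h1 := (Finset.sum_eq_zero_iff_of_nonneg (fun i _ => sq_nonneg _)).mp h.symm i₁
    (Finset.mem_univ _)
  have h01 : i₁ ≠ i₀ := by simp [i₀, i₁]
  have hn' : (n : ℝ) ≠ 0 := Nat.cast_ne_zero.mpr (by omega)
  simp [h01, hn'] at h1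

theorem spectrum_pos_eq (G : WeightedGraph n) :
    {t : ℝ | t ∈ spectrum ℝ G.laplacian ∧ 0 < t} = G.eig '' (G.posModes : Set (Fin n)) := by
  ext t
  rw [Set.mem_ofPred_eq, G.isHermitian_laplacian.spectrum_real_eq_range_eigenvalues]
  constructor
  · rintro ⟨⟨a, rfl⟩, h⟩
    exact ⟨a, mem_posModes.mpr (ne_of_gt h), rfl⟩
  · rintro ⟨a, ha, rfl⟩
    exact ⟨⟨a, rfl⟩, (G.eig_nonneg a).lt_of_ne' (mem_posModes.mp ha)⟩

theorem rho2_le_eig (G : WeightedGraph n) {a : Fin n} (ha : a ∈ G.posModes) :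
    G.rho2 ≤ G.eig a := by
  rw [rho2, spectrum_pos_eq]
  exact csInf_le ((Set.toFinite _).image _).bddBelow ⟨a, ha, rfl⟩

theorem rho2_pos (G : WeightedGraph n) (hG : G.Connected) (hn : 2 ≤ n) : 0 < G.rho2 := by
  rw [rho2, spectrum_pos_eq]
  have hne : (G.eig '' (G.posModes : Set (Fin n))).Nonempty :=
    (Finset.coe_nonempty.mpr (G.posModes_nonempty hG hn)).image _
  obtain ⟨a, ha, h⟩ := hne.csInf_mem ((Set.toFinite _).image _)
  rw [← h]
  exact (G.eig_nonneg a).lt_of_ne' (mem_posModes.mp ha)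

theorem rho2_le_rho (G : WeightedGraph n) (hG : G.Connected) (hn : 2 ≤ n) : G.rho2 ≤ G.rho := by
  obtain ⟨a, ha⟩ := G.posModes_nonempty hG hn
  exact (G.rho2_le_eig ha).trans (G.eig_le_rho a)

end WeightedGraph

/-! ### One step of the algorithm in one eigenmode -/

section Mode

variable {E : Type*} [NormedAddCommGroup E] [InnerProductSpace ℝ E]

/-- The energy of one mode with eigenvalue `l`: the quadratic part of the Lyapunov function. -/
noncomputable def modeEnergy (l r : ℝ) (x w : E) : ℝ :=
  1 / 2 * ‖x‖ ^ 2 + 1 / 2 * (1 / l + r) * ‖w‖ ^ 2 + inner ℝ x w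

/-- The exact change of the energy of a mode. The weights in `modeEnergy` are such that the two
first-order terms in `⟪x, w⟫` cancel. -/
theorem modeEnergy_step {l α β η : ℝ} (hl : l ≠ 0) (hβ : β ≠ 0) (x w d t : E) :
    modeEnergy l (α / β) (x - η • ((α * l) • x + β • w + d))
        (w + (η * β * l) • x + (1 / β) • t) =
      modeEnergy l (α / β) x w - η * ((α - β) * l) * ‖x‖ ^ 2 - η * β * ‖w‖ ^ 2
        - η * inner ℝ x d - η * inner ℝ w d + 1 / β * inner ℝ x t
        + 1 / β * (1 / l + α / β) * inner ℝ w t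
        + 1 / 2 * (1 / l + α / β) * ‖(η * β * l) • x + (1 / β) • t‖ ^ 2
        + η ^ 2 * (1 / 2 * (α ^ 2 * l ^ 2 * ‖x‖ ^ 2 + β ^ 2 * ‖w‖ ^ 2 + ‖d‖ ^ 2)
          - α * β * l ^ 2 * ‖x‖ ^ 2 + (α - β) * l * β * inner ℝ x w
          + (α - β) * l * inner ℝ x d + β * inner ℝ w d)
        - η * inner ℝ w t - η / β * (α * l) * inner ℝ x t - η / β * inner ℝ d t := by
  have e1 := real_inner_comm w x
  have e2 := real_inner_comm d x
  have e3 := real_inner_comm t x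
  have e4 := real_inner_comm d w
  have e5 := real_inner_comm t w
  have e6 := real_inner_comm t d
  simp only [modeEnergy, ← real_inner_self_eq_norm_sq, inner_add_left, inner_add_right,
    inner_sub_left, inner_sub_right, real_inner_smul_left, real_inner_smul_right, e1, e2, e3, e4,
    e5, e6]
  field_simp
  ring

/-- Young's inequality. -/
theorem neg_inner_le {c : ℝ} (hc : 0 < c) (x y : E) :
    -inner ℝ x y ≤ c / 2 * ‖x‖ ^ 2 + 1 / (2 * c) * ‖y‖ ^ 2 := by
  have h := norm_add_sq_real (c • x) y
  rw [norm_smul, mul_pow, Real.norm_eq_abs, sq_abs, real_inner_smul_left] at h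
  have h2 : c / 2 * ‖x‖ ^ 2 + 1 / (2 * c) * ‖y‖ ^ 2 + inner ℝ x y =
      1 / (2 * c) * ‖c • x + y‖ ^ 2 := by
    rw [h]; field_simp; ring
  have h3 : 0 ≤ 1 / (2 * c) * ‖c • x + y‖ ^ 2 := by positivity
  linarith

theorem inner_le {c : ℝ} (hc : 0 < c) (x y : E) :
    inner ℝ x y ≤ c / 2 * ‖x‖ ^ 2 + 1 / (2 * c) * ‖y‖ ^ 2 := by
  have h := neg_inner_le hc x (-y)
  rwa [inner_neg_right, neg_neg, norm_neg] at h

theorem norm_add_sq_le (x y : E) : ‖x + y‖ ^ 2 ≤ 2 * ‖x‖ ^ 2 + 2 * ‖y‖ ^ 2 := by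
  have h1 := norm_add_sq_real x y
  have h2 := inner_le one_pos x y
  linarith

/-- The energy decrease of one mode. The perturbation `d` is the gradient error caused by
disagreement, `t` the increment of the gradients at the average; `θ` is the weight of Young's
inequality for the term `⟪x, t⟫`. -/
theorem modeEnergy_step_le {l ρ₂ ρ α β η L θ : ℝ} (hρ₂ : 0 < ρ₂) (hl₂ : ρ₂ ≤ l) (hl : l ≤ ρ)
    (hβ : 0 < β) (hαβ : β < α) (hη : 0 < η) (hL : 0 < L) (hθ : 0 < θ) (x w d t : E) :
    modeEnergy l (α / β) (x - η • ((α * l) • x + β • w + d))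
        (w + (η * β * l) • x + (1 / β) • t) ≤
      modeEnergy l (α / β) x w
        - η * ((α - β) * ρ₂ - L / 2 - θ / 2 - η * (β ^ 2 * ρ + (2 * α ^ 2 + β ^ 2) * ρ ^ 2))
          * ‖x‖ ^ 2
        - η * (β - 1 / 2 - (1 / ρ₂ + α / β) / (2 * β) - η * (2 * β ^ 2 + 1 / 2)) * ‖w‖ ^ 2
        + η * (1 / (2 * L) + 1 / 2 + 5 / 2 * η) * ‖d‖ ^ 2
        + (1 / (2 * θ * η * β ^ 2) + (1 / ρ₂ + α / β) / (2 * η * β) + (1 / ρ₂ + α / β) / β ^ 2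
          + 1 / β ^ 2 + 1 / 2) * ‖t‖ ^ 2 := by
  have hl0 : 0 < l := hρ₂.trans_le hl₂
  have hα : 0 < α := hβ.trans hαβ
  have hp : 1 / l ≤ 1 / ρ₂ := one_div_le_one_div_of_le hρ₂ hl₂
  rw [modeEnergy_step hl0.ne' hβ.ne']
  set X := ‖x‖ ^ 2 with hX
  set W := ‖w‖ ^ 2 with hW
  set D := ‖d‖ ^ 2 with hD
  set T := ‖t‖ ^ 2 with hT
  have hX0 : 0 ≤ X := sq_nonneg _
  have hW0 : 0 ≤ W := sq_nonneg _
  have hD0 : 0 ≤ D := sq_nonneg _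
  have hT0 : 0 ≤ T := sq_nonneg _
  have hm : 0 < 1 / l + α / β := by positivity
  -- Young's inequality for the terms of `modeEnergy_step`, in their order.
  have y1 : -(η * inner ℝ x d) ≤ η * (L / 2 * X + 1 / (2 * L) * D) := by
    have := mul_le_mul_of_nonneg_left (neg_inner_le hL x d) hη.le
    linarith
  have y2 : -(η * inner ℝ w d) ≤ η * (1 / 2 * W + 1 / 2 * D) := by
    have := mul_le_mul_of_nonneg_left (neg_inner_le one_pos w d) hη.le
    linarith
  have y3 : 1 / β * inner ℝ x t ≤ η * θ / 2 * X + 1 / (2 * θ * η * β ^ 2) * T := by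
    have h := inner_le (mul_pos hη hθ) x ((1 / β) • t)
    rw [real_inner_smul_right, norm_smul, mul_pow, Real.norm_eq_abs, sq_abs] at h
    refine h.trans (le_of_eq ?_)
    rw [← hX, ← hT]; field_simp
  have y4 : 1 / β * (1 / l + α / β) * inner ℝ w t ≤
      1 / β * (1 / ρ₂ + α / β) * (η / 2 * W + 1 / (2 * η) * T) := by
    have h := inner_le hη w t
    have h0 : 0 ≤ η / 2 * W + 1 / (2 * η) * T := by positivity
    calc _ ≤ 1 / β * (1 / l + α / β) * (η / 2 * W + 1 / (2 * η) * T) :=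
          mul_le_mul_of_nonneg_left h (by positivity)
      _ ≤ _ := by gcongr
  have y5 : 1 / 2 * (1 / l + α / β) * ‖(η * β * l) • x + (1 / β) • t‖ ^ 2 ≤
      η ^ 2 * (β ^ 2 * l + α * β * l ^ 2) * X + (1 / ρ₂ + α / β) / β ^ 2 * T := by
    have h := norm_add_sq_le ((η * β * l) • x) ((1 / β) • t)
    simp only [norm_smul, mul_pow, Real.norm_eq_abs, sq_abs] at h
    calc _ ≤ 1 / 2 * (1 / l + α / β) *
            (2 * ((η ^ 2 * β ^ 2 * l ^ 2) * X) + 2 * ((1 / β) ^ 2 * T)) := by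
          refine mul_le_mul_of_nonneg_left (h.trans (le_of_eq ?_)) (by positivity)
          ring
      _ = η ^ 2 * (β ^ 2 * l + α * β * l ^ 2) * X + (1 / l + α / β) / β ^ 2 * T := by
          field_simp
      _ ≤ _ := by gcongr
  have y6 : -(η * inner ℝ w t) ≤ η ^ 2 / 2 * W + 1 / 2 * T := by
    have := mul_le_mul_of_nonneg_left (neg_inner_le hη w t) hη.le
    have e : η * (η / 2 * W + 1 / (2 * η) * T) = η ^ 2 / 2 * W + 1 / 2 * T := by field_simp
    linarith
  have y7 : -(η / β * (α * l) * inner ℝ x t) ≤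
      η ^ 2 * (α ^ 2 * l ^ 2) / 2 * X + 1 / (2 * β ^ 2) * T := by
    have h := neg_inner_le one_pos ((η * α * l) • x) ((1 / β) • t)
    simp only [real_inner_smul_left, real_inner_smul_right, norm_smul, mul_pow, Real.norm_eq_abs,
      sq_abs] at h
    have e1 : -(η / β * (α * l) * inner ℝ x t) = -(1 / β * (η * α * l * inner ℝ x t)) := by ring
    rw [e1]
    refine h.trans (le_of_eq ?_)
    rw [← hX, ← hT]; field_simp
  have y8 : -(η / β * inner ℝ d t) ≤ η ^ 2 / 2 * D + 1 / (2 * β ^ 2) * T := by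
    have h := neg_inner_le one_pos (η • d) ((1 / β) • t)
    simp only [real_inner_smul_left, real_inner_smul_right, norm_smul, mul_pow, Real.norm_eq_abs,
      sq_abs] at h
    have e1 : -(η / β * inner ℝ d t) = -(1 / β * (η * inner ℝ d t)) := by ring
    rw [e1]
    refine h.trans (le_of_eq ?_)
    rw [← hD, ← hT]; field_simp
  have y9 : (α - β) * l * β * inner ℝ x w + (α - β) * l * inner ℝ x d + β * inner ℝ w d ≤
      (α - β) ^ 2 * l ^ 2 * X + β ^ 2 * W + D := by
    have h1 := inner_le one_pos (((α - β) * l) • x) (β • w)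
    have h2 := inner_le one_pos (((α - β) * l) • x) d
    have h3 := inner_le one_pos (β • w) d
    simp only [real_inner_smul_left, real_inner_smul_right, norm_smul, mul_pow, Real.norm_eq_abs,
      sq_abs] at h1 h2 h3
    linarith
  have y9' := mul_le_mul_of_nonneg_left y9 (sq_nonneg η)
  -- The eigenvalue is replaced by its bounds `ρ₂` and `ρ`; the coefficient of `l ^ 2` collected
  -- from the second-order terms is `2 α² - 2 α β + β²`.
  have z1 : η * ((α - β) * ρ₂) * X ≤ η * ((α - β) * l) * X := by
    have : 0 ≤ α - β := by linarith
    gcongr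
  have z2 : η ^ 2 * (β ^ 2 * l + (2 * α ^ 2 - 2 * (α * β) + β ^ 2) * l ^ 2) * X ≤
      η ^ 2 * (β ^ 2 * ρ + (2 * α ^ 2 + β ^ 2) * ρ ^ 2) * X := by
    have : 0 < α * β := mul_pos hα hβ
    have h2 : 2 * α ^ 2 - 2 * (α * β) + β ^ 2 ≤ 2 * α ^ 2 + β ^ 2 := by linarith
    have h3 : l ^ 2 ≤ ρ ^ 2 := by gcongr
    gcongr
  have z3 : 0 ≤ η ^ 2 * β ^ 2 * W := by positivity
  have z4 : 0 ≤ η ^ 2 * D := by positivity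
  have e4 : 1 / β * (1 / ρ₂ + α / β) * (η / 2 * W + 1 / (2 * η) * T) =
      η * ((1 / ρ₂ + α / β) / (2 * β)) * W + (1 / ρ₂ + α / β) / (2 * η * β) * T := by
    field_simp
  have e5 : (1 / β ^ 2) * T = 1 / (2 * β ^ 2) * T + 1 / (2 * β ^ 2) * T := by field_simp; ring
  rw [e4] at y4
  linear_combination y1 + y2 + y3 + y4 + y5 + y6 + y7 + y8 + y9' + z1 + z2 + (1 / 2) * z3
    + (1 / 2) * z4 - e5

theorem modeEnergy_le {l ρ₂ r : ℝ} (hρ₂ : 0 < ρ₂) (hl₂ : ρ₂ ≤ l) (hr : 1 ≤ r) (x w : E) :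
    modeEnergy l r x w ≤ ((r + 1) / 2 + 1 / (2 * ρ₂)) * (‖x‖ ^ 2 + ‖w‖ ^ 2) := by
  have h := inner_le one_pos x w
  have hp : 1 / l ≤ 1 / ρ₂ := one_div_le_one_div_of_le hρ₂ hl₂
  have hp2 : 0 < 1 / ρ₂ := by positivity
  have e : 1 / (2 * ρ₂) = 1 / 2 * (1 / ρ₂) := by field_simp
  have h1 : 0 ≤ (1 / ρ₂ - 1 / l) * ‖w‖ ^ 2 := mul_nonneg (by linarith) (sq_nonneg _)
  have h2 : 0 ≤ (r - 1 + 1 / ρ₂) * ‖x‖ ^ 2 := mul_nonneg (by linarith) (sq_nonneg _)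
  rw [modeEnergy, e]
  linear_combination h + 1 / 2 * h1 + 1 / 2 * h2

/-- Young's inequality with weight `β / α` (here `r = α / β`) yields both terms of the minimum
`ε₉`. -/
theorem le_modeEnergy {l ρ r c : ℝ} (hl0 : 0 < l) (hl : l ≤ ρ) (hr : 0 < r)
    (h1 : c ≤ 1 / (2 * ρ)) (h2 : c ≤ (1 - 1 / r) / 2) (x w : E) :
    c * (‖x‖ ^ 2 + ‖w‖ ^ 2) ≤ modeEnergy l r x w := by
  have h := neg_inner_le (inv_pos.mpr hr) x w
  have hp : 1 / ρ ≤ 1 / l := one_div_le_one_div_of_le hl0 hl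
  have hρ : 0 < ρ := hl0.trans_le hl
  have e : 1 / (2 * ρ) = 1 / 2 * (1 / ρ) := by field_simp
  have e1 : 1 / (2 * r⁻¹) = r / 2 := by field_simp
  rw [e1, inv_eq_one_div] at h
  have h3 : 0 ≤ ((1 - 1 / r) / 2 - c) * ‖x‖ ^ 2 := mul_nonneg (by linarith) (sq_nonneg _)
  have h4 : 0 ≤ (1 / 2 * (1 / l) - c) * ‖w‖ ^ 2 := mul_nonneg (by linarith) (sq_nonneg _)
  rw [modeEnergy]
  linear_combination h + h3 + h4

end Mode

/-! ### Smooth functions and the Polyak–Łojasiewicz condition -/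

section Smooth

variable {n p : ℕ}

theorem SmoothWith.hasGradientAt {f : Vec p → ℝ} {L : ℝ} (hf : SmoothWith f L) (x : Vec p) :
    HasGradientAt f (gradient f x) x := (hf.2.1 x).hasGradientAt

/-- The descent lemma. -/
theorem SmoothWith.le_add_inner {f : Vec p → ℝ} {L : ℝ} (hf : SmoothWith f L) (x y : Vec p) :
    f y ≤ f x + inner ℝ (gradient f x) (y - x) + L / 2 * ‖y - x‖ ^ 2 := by
  set h : Vec p := y - x with hh
  have hline : ∀ t : ℝ, HasDerivAt (fun t : ℝ => f (x + t • h))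
      (inner ℝ (gradient f (x + t • h)) h) t := by
    intro t
    have h1 : HasDerivAt (fun t : ℝ => x + t • h) h t := by
      simpa using ((hasDerivAt_id t).smul_const h).const_add x
    have h2 := (hf.hasGradientAt (x + t • h)).hasFDerivAt.comp_hasDerivAt t h1
    simp only [InnerProductSpace.toDual_apply_apply] at h2
    exact h2
  have hB : ∀ t : ℝ, HasDerivAt
      (fun t : ℝ => f x + t * inner ℝ (gradient f x) h + L / 2 * t ^ 2 * ‖h‖ ^ 2)
      (inner ℝ (gradient f x) h + L * t * ‖h‖ ^ 2) t := by
    intro t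
    have h1 := ((hasDerivAt_id t).mul_const (inner ℝ (gradient f x) h)).const_add (f x)
    have h2 := (((hasDerivAt_id t).pow 2).const_mul (L / 2)).mul_const (‖h‖ ^ 2)
    refine (h1.add h2).congr_deriv ?_
    simp only [id, one_mul, Nat.cast_ofNat, Nat.add_one_sub_one, pow_one, mul_one]
    ring
  have key := image_le_of_deriv_right_le_deriv_boundary
    (f := fun t : ℝ => f (x + t • h)) (a := 0) (b := 1)
    (fun t _ => (hline t).continuousAt.continuousWithinAt)
    (fun t _ => (hline t).hasDerivWithinAt) (B := fun t : ℝ =>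
      f x + t * inner ℝ (gradient f x) h + L / 2 * t ^ 2 * ‖h‖ ^ 2) (by simp)
    (fun t _ => (hB t).continuousAt.continuousWithinAt)
    (fun t _ => (hB t).hasDerivWithinAt) (fun t ht => ?_) (Set.right_mem_Icc.mpr zero_le_one)
  · simpa [hh] using key
  · have h1 : inner ℝ (gradient f (x + t • h) - gradient f x) h ≤ L * t * ‖h‖ ^ 2 := by
      have h2 := hf.2.2 (x + t • h) x
      rw [add_sub_cancel_left, norm_smul, Real.norm_eq_abs, abs_of_nonneg ht.1] at h2
      calc _ ≤ ‖gradient f (x + t • h) - gradient f x‖ * ‖h‖ := real_inner_le_norm _ _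
        _ ≤ L * (t * ‖h‖) * ‖h‖ := by gcongr
        _ = _ := by ring
    rw [inner_sub_left] at h1
    linarith

theorem gradient_globalCost {f : Fin n → Vec p → ℝ} (hf : ∀ i, Differentiable ℝ (f i))
    (x : Vec p) : HasGradientAt (globalCost f) ((1 / (n : ℝ)) • ∑ i, gradient (f i) x) x := by
  rw [hasGradientAt_iff_hasFDerivAt]
  have h1 : HasFDerivAt (fun y => ∑ i, f i y)
      (∑ i, (InnerProductSpace.toDual ℝ (Vec p)) (gradient (f i) x)) x :=
    HasFDerivAt.fun_sum fun i _ => ((hf i x).hasGradientAt).hasFDerivAt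
  have h2 := h1.const_mul (1 / (n : ℝ))
  rw [map_smul, map_sum]
  exact h2

theorem SmoothWith.globalCost {f : Fin n → Vec p → ℝ} {L : ℝ} (hn : n ≠ 0)
    (hf : ∀ i, SmoothWith (f i) L) : SmoothWith (DistOpt.globalCost f) L := by
  have hd : ∀ i, Differentiable ℝ (f i) := fun i => (hf i).2.1
  have hn' : (0 : ℝ) < n := Nat.cast_pos.mpr (Nat.pos_of_ne_zero hn)
  refine ⟨(hf ⟨0, Nat.pos_of_ne_zero hn⟩).1,
    fun x => (gradient_globalCost hd x).differentiableAt, fun x y => ?_⟩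
  rw [(gradient_globalCost hd x).gradient, (gradient_globalCost hd y).gradient, ← smul_sub,
    ← Finset.sum_sub_distrib, norm_smul, Real.norm_eq_abs, abs_of_pos (by positivity)]
  calc 1 / (n : ℝ) * ‖∑ i, (gradient (f i) x - gradient (f i) y)‖
      ≤ 1 / (n : ℝ) * ∑ _i : Fin n, L * ‖x - y‖ := by
        gcongr
        exact norm_sum_le_of_le _ fun i _ => (hf i).2.2 x y
    _ = L * ‖x - y‖ := by
        rw [Finset.sum_const, Finset.card_univ, Fintype.card_fin, nsmul_eq_mul]
        field_simp

theorem optimalValue_eq {f : Vec p → ℝ} {y : Vec p} (hy : y ∈ optimalSet f) :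
    optimalValue f = f y :=
  le_antisymm (ciInf_le ⟨f y, by rintro _ ⟨z, rfl⟩; exact hy z⟩ y) (le_ciInf hy)

theorem optimalValue_le {f : Vec p → ℝ} (h : (optimalSet f).Nonempty) (x : Vec p) :
    optimalValue f ≤ f x := by
  obtain ⟨y, hy⟩ := h
  rw [optimalValue_eq hy]; exact hy x

/-- A function that at `y` decreases at most with slope `c` has a gradient of norm at most `c`
there. -/
theorem norm_gradient_le_of_slope {g : Vec p → ℝ} {y v : Vec p} {c : ℝ} (hc : 0 ≤ c)
    (hg : HasGradientAt g v y)
    (h : ∀ z, g y ≤ g z + c * ‖z - y‖) : ‖v‖ ≤ c := by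
  have hline : HasDerivAt (fun t : ℝ => g (y - t • v) + t * (c * ‖v‖))
      (-‖v‖ ^ 2 + c * ‖v‖) 0 := by
    have h1 : HasDerivAt (fun t : ℝ => y - t • v) (-v) 0 := by
      simpa using ((hasDerivAt_id (0 : ℝ)).smul_const v).const_sub y
    have hg' : HasGradientAt g v (y - (0 : ℝ) • v) := by simpa using hg
    have h2 := hg'.hasFDerivAt.comp_hasDerivAt (0 : ℝ) h1
    have h3 := h2.add ((hasDerivAt_id (0 : ℝ)).mul_const (c * ‖v‖))
    refine h3.congr_deriv ?_
    simp
  have hslope := hline.tendsto_slope_zero_right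
  have hnn : 0 ≤ -‖v‖ ^ 2 + c * ‖v‖ := by
    refine ge_of_tendsto hslope ?_
    filter_upwards [self_mem_nhdsWithin] with t ht
    have ht' : (0 : ℝ) < t := ht
    have h1 := h (y - t • v)
    rw [sub_sub_cancel_left, norm_neg, norm_smul, Real.norm_eq_abs, abs_of_pos ht'] at h1
    simp only [zero_add, zero_smul, sub_zero, zero_mul, add_zero, smul_eq_mul]
    refine mul_nonneg (inv_nonneg.mpr ht'.le) ?_
    linarith
  rcases (norm_nonneg v).eq_or_lt' with h0 | h0
  · rwa [h0]
  · nlinarith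

/-- The minimizer of `√(f - f*) + c ‖· - x‖` minimizes `f`: elsewhere the slope of `√(f - f*)` is
at least `√(ν / 2) > c` by the Polyak–Łojasiewicz condition. -/
theorem PolyakLojasiewicz.exists_optimal {f : Vec p → ℝ} {ν c : ℝ} (hPL : PolyakLojasiewicz f ν)
    (hf : Differentiable ℝ f) (hopt : (optimalSet f).Nonempty) (hc : 0 < c) (hcν : c ^ 2 < ν / 2)
    (x : Vec p) : ∃ y ∈ optimalSet f, c * ‖y - x‖ ≤ √(f x - optimalValue f) := by
  have hcont : Continuous fun z => √(f z - optimalValue f) + c * ‖z - x‖ :=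
    (hf.continuous.sub continuous_const).sqrt.add
      (continuous_const.mul (continuous_id.sub continuous_const).norm)
  have hlim : Filter.Tendsto (fun z => √(f z - optimalValue f) + c * ‖z - x‖)
      (Filter.cocompact (Vec p)) Filter.atTop := by
    have h1 : Filter.Tendsto (fun z : Vec p => c * (‖z‖ - ‖x‖)) (Filter.cocompact (Vec p))
        Filter.atTop :=
      (Filter.tendsto_atTop_add_const_right _ _ (tendsto_norm_cocompact_atTop)).const_mul_atTop hc
    refine Filter.tendsto_atTop_mono (fun z => ?_) h1
    have h2 := mul_le_mul_of_nonneg_left (norm_sub_norm_le z x) hc.le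
    have h3 := Real.sqrt_nonneg (f z - optimalValue f)
    linarith
  obtain ⟨y, hy⟩ := hcont.exists_forall_le hlim
  have hy_opt : f y ≤ optimalValue f := by
    by_contra! hlt
    have hpos : 0 < f y - optimalValue f := sub_pos.mpr hlt
    have hs : 0 < √(f y - optimalValue f) := Real.sqrt_pos.mpr hpos
    have hgrad : HasGradientAt (fun z => √(f z - optimalValue f))
        ((1 / (2 * √(f y - optimalValue f))) • gradient f y) y := by
      have h1 := ((hf y).hasGradientAt.hasFDerivAt.sub_const (optimalValue f)).sqrt hpos.ne'
      rw [hasGradientAt_iff_hasFDerivAt, map_smul]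
      exact h1
    have hle := norm_gradient_le_of_slope hc.le hgrad (fun z => by
      have h1 := hy z
      have h2 := mul_le_mul_of_nonneg_left (norm_sub_le_norm_sub_add_norm_sub z y x) hc.le
      linarith)
    rw [norm_smul, Real.norm_eq_abs, abs_of_pos (by positivity), one_div_mul_eq_div,
      div_le_iff₀ (by positivity)] at hle
    have h1 : ‖gradient f y‖ ^ 2 ≤ 4 * c ^ 2 * (f y - optimalValue f) := by
      calc ‖gradient f y‖ ^ 2 ≤ (c * (2 * √(f y - optimalValue f))) ^ 2 := by gcongr
        _ = 4 * c ^ 2 * √(f y - optimalValue f) ^ 2 := by ring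
        _ = _ := by rw [Real.sq_sqrt hpos.le]
    have h2 := hPL.2 y
    nlinarith
  refine ⟨y, fun z => hy_opt.trans (optimalValue_le hopt z), ?_⟩
  have h1 := hy x
  have h2 := Real.sqrt_nonneg (f y - optimalValue f)
  rw [sub_self, norm_zero, mul_zero, add_zero] at h1
  linarith

/-- The Polyak–Łojasiewicz condition implies quadratic growth. -/
theorem PolyakLojasiewicz.quadratic_growth {f : Vec p → ℝ} {ν : ℝ} (hPL : PolyakLojasiewicz f ν)
    (hf : Differentiable ℝ f) (hopt : (optimalSet f).Nonempty) {P : Vec p → Vec p}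
    (hP : IsProjectionOnto (optimalSet f) P) (x : Vec p) :
    ν / 2 * ‖x - P x‖ ^ 2 ≤ f x - optimalValue f := by
  have hν := hPL.1
  have hmem : P x ∈ nearestPoints (optimalSet f) x := by rw [hP x]; rfl
  have hf0 : 0 ≤ f x - optimalValue f := sub_nonneg.mpr (optimalValue_le hopt x)
  have key : ∀ b ∈ Set.Ioo 0 (ν / 2), b * ‖x - P x‖ ^ 2 ≤ f x - optimalValue f := by
    intro b hb
    obtain ⟨y, hy, hle⟩ := hPL.exists_optimal hf hopt (Real.sqrt_pos.mpr hb.1)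
      (by rw [Real.sq_sqrt hb.1.le]; exact hb.2) x
    have h1 := pow_le_pow_left₀ (by positivity) hle 2
    rw [mul_pow, Real.sq_sqrt hb.1.le, Real.sq_sqrt hf0, norm_sub_rev] at h1
    exact (mul_le_mul_of_nonneg_left (hmem.2 y hy) hb.1.le).trans h1
  have hlim : Filter.Tendsto (fun b : ℝ => b * ‖x - P x‖ ^ 2) (nhdsWithin (ν / 2) (Set.Iio (ν / 2)))
      (nhds (ν / 2 * ‖x - P x‖ ^ 2)) :=
    ((continuous_id.mul continuous_const).tendsto _).mono_left nhdsWithin_le_nhds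
  refine le_of_tendsto hlim ?_
  filter_upwards [Ioo_mem_nhdsLT (half_pos hν)] with b hb using key b hb

end Smooth

/-! ### One step of the algorithm -/

section Step

variable {n p : ℕ}

theorem blockForm_centering (hn : n ≠ 0) (z : Stacked n p) :
    blockForm (centering n) z = ∑ i, ‖z i - average z‖ ^ 2 := by
  have hn' : (n : ℝ) ≠ 0 := Nat.cast_ne_zero.mpr hn
  have hsum : ∑ i, z i = (n : ℝ) • average z := by
    rw [average, smul_smul, mul_one_div_cancel hn', one_smul]
  have h1 : ∀ i, ∑ j, centering n i j * inner ℝ (z i) (z j) =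
      ‖z i‖ ^ 2 - inner ℝ (z i) (average z) := by
    intro i
    simp only [centering, Matrix.sub_apply, Matrix.smul_apply, Matrix.of_apply, Matrix.one_apply,
      smul_eq_mul, mul_one, sub_mul, ite_mul, one_mul, zero_mul, Finset.sum_sub_distrib,
      Finset.sum_ite_eq, Finset.mem_univ, if_true, real_inner_self_eq_norm_sq]
    rw [← Finset.mul_sum, ← inner_sum, average, real_inner_smul_right]
  have h2 : ∑ i, inner ℝ (z i) (average z) = n * ‖average z‖ ^ 2 := by
    rw [← sum_inner, hsum, real_inner_smul_left, real_inner_self_eq_norm_sq]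
  simp only [blockForm, h1, norm_sub_sq_real, Finset.sum_add_distrib, Finset.sum_sub_distrib,
    ← Finset.mul_sum, h2]
  simp
  ring

theorem sum_posModes_eq_blockForm (G : WeightedGraph n) (hG : G.Connected) (hn : n ≠ 0)
    (z : Stacked n p) :
    ∑ a ∈ G.posModes, ‖G.mode a fun i => z i‖ ^ 2 = blockForm (centering n) z := by
  rw [blockForm_centering hn, G.sum_posModes hG hn]
  rfl

theorem norm_sub_consensus_sq (z : Stacked n p) (y : Vec p) :
    ‖z - consensus n y‖ ^ 2 = ∑ i, ‖z i - y‖ ^ 2 := by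
  rw [PiLp.norm_sq_eq_of_L2]
  rfl

/-- The parallel axis identity. -/
theorem sum_norm_sub_sq (hn : n ≠ 0) (z : Stacked n p) (y : Vec p) :
    ∑ i, ‖z i - y‖ ^ 2 = ∑ i, ‖z i - average z‖ ^ 2 + n * ‖average z - y‖ ^ 2 := by
  have hn' : (n : ℝ) ≠ 0 := Nat.cast_ne_zero.mpr hn
  have hsum : ∑ i, (z i - average z) = 0 := by
    rw [Finset.sum_sub_distrib, Finset.sum_const, Finset.card_univ, Fintype.card_fin,
      ← Nat.cast_smul_eq_nsmul ℝ, average, smul_smul, mul_one_div_cancel hn', one_smul, sub_self]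
  have h1 : ∀ i, ‖z i - y‖ ^ 2 = ‖z i - average z‖ ^ 2
      + 2 * inner ℝ (z i - average z) (average z - y) + ‖average z - y‖ ^ 2 := by
    intro i
    rw [← norm_add_sq_real, sub_add_sub_cancel]
  simp only [h1, Finset.sum_add_distrib, ← Finset.mul_sum]
  rw [← sum_inner, hsum, inner_zero_left]
  simp

theorem norm_average_sq_le (hn : n ≠ 0) (y : Fin n → Vec p) :
    n * ‖(1 / (n : ℝ)) • ∑ i, y i‖ ^ 2 ≤ ∑ i, ‖y i‖ ^ 2 := by
  have h := sum_norm_sub_sq hn (WithLp.toLp 2 y) 0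
  simp only [sub_zero, average] at h
  rw [h]
  have : 0 ≤ ∑ i, ‖y i - (1 / (n : ℝ)) • ∑ j, y j‖ ^ 2 :=
    Finset.sum_nonneg fun i _ => sq_nonneg _
  linarith

/-- The average of the local gradients, each at the point of its own agent. -/
noncomputable def meanGradient (f : Fin n → Vec p → ℝ) (x : Stacked n p) : Vec p :=
  (1 / (n : ℝ)) • ∑ i, gradient (f i) (x i)

/-- The dual error `v + g⁰ / β`, where `g⁰` collects the local gradients at the average of `x`. -/
noncomputable def dualError (f : Fin n → Vec p → ℝ) (β : ℝ) (x v : Stacked n p) : Stacked n p :=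
  v + (1 / β) • stackedGradient f (consensus n (average x))

theorem dualError_apply (f : Fin n → Vec p → ℝ) (β : ℝ) (x v : Stacked n p) (i : Fin n) :
    dualError f β x v i = v i + (1 / β) • gradient (f i) (average x) := rfl

/-- The sum of the mode energies: the quadratic part of the Lyapunov function. -/
noncomputable def energy (G : WeightedGraph n) (r : ℝ) (x w : Stacked n p) : ℝ :=
  ∑ a ∈ G.posModes, modeEnergy (G.eig a) r (G.mode a fun i => x i) (G.mode a fun i => w i)

theorem sum_laplacian_smul (G : WeightedGraph n) (x : Fin n → Vec p) :
    ∑ i, ∑ j, G.laplacian i j • x j = 0 := by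
  rw [Finset.sum_comm]
  refine Finset.sum_eq_zero fun j _ => ?_
  rw [← Finset.sum_smul]
  simp_rw [fun i => G.laplacian_symm i j]
  rw [G.sum_laplacian, zero_smul]

section Run

variable {G : WeightedGraph n} {f : Fin n → Vec p → ℝ} {α β η L : ℝ} {x v : ℕ → Stacked n p}

theorem IsPrimalDualRun.sum_v (h : IsPrimalDualRun G f α β η x v) (k : ℕ) : ∑ i, v k i = 0 := by
  induction k with
  | zero => exact h.init
  | succ k ih =>
    simp only [h.step_v, Finset.sum_add_distrib, ih, ← Finset.smul_sum, sum_laplacian_smul]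
    simp

/-- The average follows an inexact gradient step. -/
theorem IsPrimalDualRun.average_step (h : IsPrimalDualRun G f α β η x v) (k : ℕ) :
    average (x (k + 1)) = average (x k) - η • meanGradient f (x k) := by
  simp only [average, meanGradient, h.step_x, Finset.sum_sub_distrib, ← Finset.smul_sum,
    Finset.sum_add_distrib, sum_laplacian_smul, h.sum_v, smul_zero, zero_add, smul_sub]
  rw [smul_comm]

theorem IsPrimalDualRun.mode_x (h : IsPrimalDualRun G f α β η x v) (hβ : β ≠ 0) (k : ℕ)
    (a : Fin n) : G.mode a (fun i => x (k + 1) i) = G.mode a (fun i => x k i) -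
      η • ((α * G.eig a) • G.mode a (fun i => x k i)
        + β • G.mode a (fun i => dualError f β (x k) (v k) i)
        + G.mode a (fun i => gradient (f i) (x k i) - gradient (f i) (average (x k)))) := by
  rw [mul_smul, ← G.mode_laplacian, ← G.mode_smul, ← G.mode_smul, ← G.mode_add, ← G.mode_add,
    ← G.mode_smul, ← G.mode_sub]
  congr 1
  funext i
  rw [h.step_x, dualError_apply, smul_add β, smul_smul, mul_one_div_cancel hβ, one_smul]
  congr 2
  abel

theorem IsPrimalDualRun.mode_dualError (h : IsPrimalDualRun G f α β η x v) (k : ℕ) (a : Fin n) :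
    G.mode a (fun i => dualError f β (x (k + 1)) (v (k + 1)) i) =
      G.mode a (fun i => dualError f β (x k) (v k) i)
        + (η * β * G.eig a) • G.mode a (fun i => x k i)
        + (1 / β) • G.mode a
          (fun i => gradient (f i) (average (x (k + 1))) - gradient (f i) (average (x k))) := by
  rw [mul_smul, ← G.mode_laplacian, ← G.mode_smul, ← G.mode_smul, ← G.mode_add, ← G.mode_add]
  congr 1
  funext i
  rw [dualError_apply, dualError_apply, h.step_v, smul_sub]
  abel

theorem sum_gradient_sub_sq_le (hf : ∀ i, SmoothWith (f i) L) (y z : Fin n → Vec p) :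
    ∑ i, ‖gradient (f i) (y i) - gradient (f i) (z i)‖ ^ 2 ≤ L ^ 2 * ∑ i, ‖y i - z i‖ ^ 2 := by
  rw [Finset.mul_sum]
  refine Finset.sum_le_sum fun i _ => ?_
  rw [← mul_pow]
  exact pow_le_pow_left₀ (norm_nonneg _) ((hf i).2.2 _ _) 2

/-- The decrease of the quadratic part of the Lyapunov function. The weight `θ` of Young's
inequality trades the disagreement against the increment of the average. -/
theorem IsPrimalDualRun.energy_step_le (h : IsPrimalDualRun G f α β η x v) (hn : 2 ≤ n)
    (hG : G.Connected) (hf : ∀ i, SmoothWith (f i) L) (hL : 0 < L) (hβ : 0 < β) (hαβ : β < α)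
    (hη : 0 < η) {θ : ℝ} (hθ : 0 < θ) (k : ℕ) :
    energy G (α / β) (x (k + 1)) (dualError f β (x (k + 1)) (v (k + 1))) ≤
      energy G (α / β) (x k) (dualError f β (x k) (v k))
        - η * (eps1 G L α β + 1 + L ^ 2 - L - θ / 2 - η * eps2 G L α β)
          * blockForm (centering n) (x k)
        - η * (eps3 G α β - η * eps4 β) * blockForm (centering n) (dualError f β (x k) (v k))
        + η * (L ^ 2 / (2 * θ * β ^ 2) + (1 / G.rho2 + α / β) * L ^ 2 / (2 * β)
          + η * (eps6 G L α β - L / 2)) * (n * ‖meanGradient f (x k)‖ ^ 2) := by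
  have hn0 : n ≠ 0 := by omega
  have hρ := G.rho2_pos hG hn
  have hα : 0 < α := hβ.trans hαβ
  set d : Fin n → Vec p := fun i => gradient (f i) (x k i) - gradient (f i) (average (x k))
  set t : Fin n → Vec p :=
    fun i => gradient (f i) (average (x (k + 1))) - gradient (f i) (average (x k))
  have hmode : ∀ a ∈ G.posModes, _ := fun a ha => modeEnergy_step_le hρ (G.rho2_le_eig ha)
    (G.eig_le_rho a) hβ hαβ hη hL hθ (G.mode a fun i => x k i)
    (G.mode a fun i => dualError f β (x k) (v k) i) (G.mode a d) (G.mode a t)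
  have hsum := Finset.sum_le_sum hmode
  simp only [Finset.sum_add_distrib, Finset.sum_sub_distrib, ← Finset.mul_sum] at hsum
  rw [sum_posModes_eq_blockForm G hG hn0, sum_posModes_eq_blockForm G hG hn0] at hsum
  have hE : energy G (α / β) (x (k + 1)) (dualError f β (x (k + 1)) (v (k + 1))) =
      ∑ a ∈ G.posModes, modeEnergy (G.eig a) (α / β)
        (G.mode a (fun i => x k i) - η • ((α * G.eig a) • G.mode a (fun i => x k i)
          + β • G.mode a (fun i => dualError f β (x k) (v k) i) + G.mode a d))
        (G.mode a (fun i => dualError f β (x k) (v k) i)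
          + (η * β * G.eig a) • G.mode a (fun i => x k i) + (1 / β) • G.mode a t) := by
    refine Finset.sum_congr rfl fun a _ => ?_
    rw [h.mode_x hβ.ne', h.mode_dualError]
  rw [hE]
  refine hsum.trans ?_
  rw [← energy]
  have hD : ∑ a ∈ G.posModes, ‖G.mode a d‖ ^ 2 ≤ L ^ 2 * blockForm (centering n) (x k) := by
    refine (G.sum_posModes_le d).trans ?_
    rw [blockForm_centering hn0]
    exact sum_gradient_sub_sq_le hf _ _
  have hT : ∑ a ∈ G.posModes, ‖G.mode a t‖ ^ 2 ≤
      L ^ 2 * (η ^ 2 * (n * ‖meanGradient f (x k)‖ ^ 2)) := by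
    refine (G.sum_posModes_le t).trans ((sum_gradient_sub_sq_le hf _ _).trans (le_of_eq ?_))
    rw [h.average_step, sub_sub_cancel_left, norm_neg, norm_smul, mul_pow, Real.norm_eq_abs, sq_abs,
      Finset.sum_const, Finset.card_univ, Fintype.card_fin, nsmul_eq_mul]
    ring
  have hD' := mul_le_mul_of_nonneg_left hD
    (show 0 ≤ η * (1 / (2 * L) + 1 / 2 + 5 / 2 * η) by positivity)
  have hT' := mul_le_mul_of_nonneg_left hT
    (show 0 ≤ 1 / (2 * θ * η * β ^ 2) + (1 / G.rho2 + α / β) / (2 * η * β)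
      + (1 / G.rho2 + α / β) / β ^ 2 + 1 / β ^ 2 + 1 / 2 by positivity)
  have e1 : η * (1 / (2 * L) + 1 / 2 + 5 / 2 * η) * (L ^ 2 * blockForm (centering n) (x k)) =
      η * (L / 2 + L ^ 2 / 2 + 5 / 2 * η * L ^ 2) * blockForm (centering n) (x k) := by
    field_simp
  have e2 : (1 / (2 * θ * η * β ^ 2) + (1 / G.rho2 + α / β) / (2 * η * β)
      + (1 / G.rho2 + α / β) / β ^ 2 + 1 / β ^ 2 + 1 / 2)
        * (L ^ 2 * (η ^ 2 * (n * ‖meanGradient f (x k)‖ ^ 2))) =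
      η * (L ^ 2 / (2 * θ * β ^ 2) + (1 / G.rho2 + α / β) * L ^ 2 / (2 * β)
          + η * (eps6 G L α β - L / 2)) * (n * ‖meanGradient f (x k)‖ ^ 2) := by
    rw [eps6]; field_simp; ring
  have e3 : eps3 G α β = β - 1 / 2 - (1 / G.rho2 + α / β) / (2 * β) := by
    rw [eps3]; field_simp; ring
  rw [e1] at hD'
  rw [e2] at hT'
  rw [e3, eps1, eps2, eps4]
  linear_combination hD' + hT'

/-- The suboptimality part `n (f(x̄) - f*)` of the Lyapunov function. -/
noncomputable def subopt (f : Fin n → Vec p → ℝ) (x : Stacked n p) : ℝ :=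
  n * (globalCost f (average x) - optimalValue (globalCost f))

theorem lyapHat_eq (f : Fin n → Vec p → ℝ) (β : ℝ) (x v : Stacked n p) :
    lyapHat f β x v = blockForm (centering n) x + blockForm (centering n) (dualError f β x v)
      + subopt f x := rfl

theorem IsPrimalDualRun.subopt_step_le (h : IsPrimalDualRun G f α β η x v) (hn : n ≠ 0)
    (hf : ∀ i, SmoothWith (f i) L) (k : ℕ) :
    subopt f (x (k + 1)) ≤ subopt f (x k)
      - η * (n * inner ℝ (meanGradient f (x k)) (gradient (globalCost f) (average (x k))))
      + η ^ 2 * (L / 2) * (n * ‖meanGradient f (x k)‖ ^ 2) := by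
  have h1 := (SmoothWith.globalCost hn hf).le_add_inner (average (x k)) (average (x (k + 1)))
  rw [h.average_step, sub_sub_cancel_left, norm_neg, norm_smul, mul_pow, Real.norm_eq_abs, sq_abs,
    inner_neg_right, real_inner_smul_right, ← h.average_step, real_inner_comm] at h1
  have h2 := mul_le_mul_of_nonneg_left h1 (Nat.cast_nonneg (α := ℝ) n)
  rw [subopt, subopt]
  linear_combination h2

/-- The mean gradient deviates from the gradient at the average by at most the disagreement. -/
theorem norm_meanGradient_sub_sq_le (hn : n ≠ 0) (hf : ∀ i, SmoothWith (f i) L)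
    (x : Stacked n p) :
    n * ‖meanGradient f x - gradient (globalCost f) (average x)‖ ^ 2 ≤
      L ^ 2 * blockForm (centering n) x := by
  rw [(gradient_globalCost (fun i => (hf i).2.1) _).gradient, meanGradient, ← smul_sub,
    ← Finset.sum_sub_distrib, blockForm_centering hn]
  exact (norm_average_sq_le hn _).trans (sum_gradient_sub_sq_le hf _ _)

end Run

theorem energy_le (G : WeightedGraph n) (hG : G.Connected) (hn : 2 ≤ n) {α β : ℝ} (hβ : 0 < β)
    (hαβ : β < α) (x w : Stacked n p) :
    energy G (α / β) x w ≤
      eps8 G α β * (blockForm (centering n) x + blockForm (centering n) w) := by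
  have hn0 : n ≠ 0 := by omega
  have h := Finset.sum_le_sum fun a (ha : a ∈ G.posModes) =>
    modeEnergy_le (G.rho2_pos hG hn) (G.rho2_le_eig ha) ((one_le_div hβ).mpr hαβ.le)
      (G.mode a fun i => x i) (G.mode a fun i => w i)
  rw [← Finset.mul_sum, Finset.sum_add_distrib, sum_posModes_eq_blockForm G hG hn0,
    sum_posModes_eq_blockForm G hG hn0] at h
  have e : eps8 G α β = (α / β + 1) / 2 + 1 / (2 * G.rho2) := by
    rw [eps8]; field_simp
  rw [e]
  exact h

theorem le_energy (G : WeightedGraph n) (hG : G.Connected) (hn : 2 ≤ n) {α β : ℝ} (hβ : 0 < β)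
    (hαβ : β < α) (x w : Stacked n p) :
    eps9 G α β * (blockForm (centering n) x + blockForm (centering n) w) ≤
      energy G (α / β) x w := by
  have hn0 : n ≠ 0 := by omega
  have hα : 0 < α := hβ.trans hαβ
  have e : (α - β) / (2 * α) = (1 - 1 / (α / β)) / 2 := by field_simp
  have h := Finset.sum_le_sum fun a (ha : a ∈ G.posModes) =>
    le_modeEnergy ((G.rho2_pos hG hn).trans_le (G.rho2_le_eig ha)) (G.eig_le_rho a)
      (div_pos hα hβ) (min_le_left _ _ : eps9 G α β ≤ _) ((min_le_right _ _).trans_eq e)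
      (G.mode a fun i => x i) (G.mode a fun i => w i)
  rw [← Finset.mul_sum, Finset.sum_add_distrib, sum_posModes_eq_blockForm G hG hn0,
    sum_posModes_eq_blockForm G hG hn0] at h
  exact h

end Step

/-! ### The parameters -/

section Parameters

variable {n : ℕ} {G : WeightedGraph n} {L κ₂ α β η : ℝ}

theorem Admissible.beta_pos (h : Admissible G L κ₂ α β η) : 0 < β := by
  have h3 : 0 < kappa3 G κ₂ := by rw [kappa3]; positivity
  exact h3.trans (((le_max_right _ _).trans (le_max_left _ _)).trans_lt h.beta_gt)

theorem Admissible.beta_lt_alpha (h : Admissible G L κ₂ α β η) (hρ : 0 < G.rho2) : β < α := by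
  have h1 : 0 < kappa1 G L := by rw [kappa1]; positivity
  linarith [h.alpha_mem.1]

theorem Admissible.eta_pos (h : Admissible G L κ₂ α β η) : 0 < η := h.eta_mem.1

/-- The positivity of `ε₁`, `ε₃` and `ε₅` is already implied by the range of `η`. -/
theorem Admissible.eps12_pos (h : Admissible G L κ₂ α β η) (hL : 0 < L) (hρ : 0 ≤ G.rho) :
    0 < eps1 G L α β - η * eps2 G L α β := by
  have h2 : 0 < eps2 G L α β := by rw [eps2]; positivity
  exact sub_pos.mpr ((lt_div_iff₀ h2).mp
    (h.eta_mem.2.trans_le ((min_le_left _ _).trans (min_le_left _ _))))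

theorem Admissible.eps34_pos (h : Admissible G L κ₂ α β η) :
    0 < eps3 G α β - η * eps4 β := by
  have h2 : 0 < eps4 β := by rw [eps4]; positivity
  exact sub_pos.mpr ((lt_div_iff₀ h2).mp
    (h.eta_mem.2.trans_le ((min_le_left _ _).trans (min_le_right _ _))))

theorem Admissible.eps56_pos (h : Admissible G L κ₂ α β η) (hL : 0 < L) (hρ : 0 < G.rho2) :
    0 < eps5 G L α β - η * eps6 G L α β := by
  have hβ := h.beta_pos
  have hα := hβ.trans (h.beta_lt_alpha hρ)
  have h2 : 0 < eps6 G L α β := by rw [eps6]; positivity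
  exact sub_pos.mpr ((lt_div_iff₀ h2).mp (h.eta_mem.2.trans_le (min_le_right _ _)))

theorem Admissible.eta_mul_beta_le (h : Admissible G L κ₂ α β η) (hρ : 0 < G.rho2) :
    η * β ≤ 1 / 2 := by
  have hβ := h.beta_pos
  have hα := hβ.trans (h.beta_lt_alpha hρ)
  have h1 := h.eps34_pos
  have h2 : 0 < α / (2 * β ^ 2) := by positivity
  have h3 : 0 < 1 / (2 * β * G.rho2) := by positivity
  have h4 := h.eta_pos
  rw [eps3, eps4] at h1
  by_contra! hc
  nlinarith

theorem one_lt_eps8 (hρ : 0 < G.rho2) (hβ : 0 < β) (hαβ : β < α) : 1 < eps8 G α β := by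
  have h1 : 1 < (α + β) / (2 * β) := by rw [one_lt_div (by positivity)]; linarith
  have h2 : 0 < 1 / (2 * G.rho2) := by positivity
  rw [eps8]; linarith

theorem eps9_pos (hρ : 0 < G.rho) (hβ : 0 < β) (hαβ : β < α) : 0 < eps9 G α β := by
  have hα := hβ.trans hαβ
  have : 0 < α - β := sub_pos.mpr hαβ
  exact lt_min (by positivity) (by positivity)

theorem eps9_le_half (hβ : 0 < β) (hαβ : β < α) : eps9 G α β ≤ 1 / 2 := by
  refine (min_le_right _ _).trans ?_
  rw [div_le_iff₀ (by linarith)]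
  linarith

theorem four_mul_eps9_le_eps8 (hρ : 0 < G.rho2) (hβ : 0 < β) (hαβ : β < α) :
    4 * eps9 G α β ≤ eps8 G α β := by
  have hα := hβ.trans hαβ
  have h1 : eps9 G α β ≤ (α - β) / (2 * α) := min_le_right _ _
  have h2 : 0 < 1 / (2 * G.rho2) := by positivity
  have h3 : 4 * ((α - β) / (2 * α)) ≤ (α + β) / (2 * β) := by
    rw [mul_div_assoc', div_le_div_iff₀ (by positivity) (by positivity)]
    nlinarith [sq_nonneg (α - 2 * β), mul_pos hα hβ]
  rw [eps8]; linarith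

theorem eps10_pos {ν : ℝ} (h : Admissible G L κ₂ α β η) (hL : 0 < L) (hρ : 0 < G.rho)
    (hν : 0 < ν) : 0 < eps10 G L α β η ν :=
  mul_pos h.eta_pos (lt_min (lt_min (h.eps12_pos hL hρ.le) h.eps34_pos) (half_pos hν))

theorem rate_pos {ν : ℝ} (h : Admissible G L κ₂ α β η) (hL : 0 < L) (hρ₂ : 0 < G.rho2)
    (hρ : 0 < G.rho) (hν : 0 < ν) : 0 < rate G L α β η ν :=
  div_pos (eps10_pos h hL hρ hν)
    (one_pos.trans (one_lt_eps8 hρ₂ h.beta_pos (h.beta_lt_alpha hρ₂)))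

theorem rate_mul_eps8 {ν : ℝ} (h : Admissible G L κ₂ α β η) (hρ₂ : 0 < G.rho2) :
    rate G L α β η ν * eps8 G α β = eps10 G L α β η ν :=
  div_mul_cancel₀ _ (one_pos.trans (one_lt_eps8 hρ₂ h.beta_pos (h.beta_lt_alpha hρ₂))).ne'

/-- With `y = η α ρ`, the first term of the minimum in `ε₁₀` gives `ε₁₀ ≤ y - 2 y² ≤ 1 / 8`. -/
theorem rate_lt_one {ν : ℝ} (h : Admissible G L κ₂ α β η) (hρ₂ : 0 < G.rho2)
    (hρ : G.rho2 ≤ G.rho) : rate G L α β η ν < 1 := by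
  have hβ := h.beta_pos
  have hαβ := h.beta_lt_alpha hρ₂
  have hα := hβ.trans hαβ
  have hη := h.eta_pos
  have hρ0 := hρ₂.trans_le hρ
  have h8 := one_lt_eps8 (G := G) hρ₂ hβ hαβ
  rw [rate, div_lt_one (by linarith)]
  refine lt_of_le_of_lt ?_ h8
  have h1 : eps10 G L α β η ν ≤ η * (eps1 G L α β - η * eps2 G L α β) :=
    mul_le_mul_of_nonneg_left ((min_le_left _ _).trans (min_le_left _ _)) hη.le
  have h2 : eps1 G L α β ≤ α * G.rho := by
    have : (α - β) * G.rho2 ≤ α * G.rho := by gcongr; linarith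
    rw [eps1]; nlinarith [sq_nonneg L]
  have h3 : 2 * (α * G.rho) ^ 2 ≤ eps2 G L α β := by
    have h4 : 0 ≤ β ^ 2 * G.rho + β ^ 2 * G.rho ^ 2 + 5 / 2 * L ^ 2 := by positivity
    rw [eps2]; linarith
  have h5 : η * (eps1 G L α β - η * eps2 G L α β) ≤
      η * (α * G.rho - η * (2 * (α * G.rho) ^ 2)) := by gcongr
  nlinarith [sq_nonneg (4 * (η * (α * G.rho)) - 1)]

end Parameters

/-! ### Decay of the Lyapunov functions -/

section Decay

variable {n p : ℕ} {G : WeightedGraph n} {f : Fin n → Vec p → ℝ} {L κ₂ α β η ν : ℝ}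
  {x v : ℕ → Stacked n p}

theorem blockForm_centering_nonneg (hn : n ≠ 0) (z : Stacked n p) :
    0 ≤ blockForm (centering n) z := by
  rw [blockForm_centering hn]
  exact Finset.sum_nonneg fun i _ => sq_nonneg _

theorem subopt_nonneg (hopt : (optimalSet (globalCost f)).Nonempty) (x : Stacked n p) :
    0 ≤ subopt f x :=
  mul_nonneg (Nat.cast_nonneg _) (sub_nonneg.mpr (optimalValue_le hopt _))

/-- The loss `ε (E + μ F)` of a Lyapunov function, bounded by the decrease of its parts. -/
theorem rate_mul_le (h : Admissible G L κ₂ α β η) (hG : G.Connected) (hn : 2 ≤ n) (hL : 0 < L)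
    (hν : 0 < ν) (hopt : (optimalSet (globalCost f)).Nonempty) {μ c : ℝ} (hμ : 0 ≤ μ)
    (hc : μ ≤ c * eps8 G α β) (x v : Stacked n p) :
    rate G L α β η ν * (energy G (α / β) x (dualError f β x v) + μ * subopt f x) ≤
      η * (eps1 G L α β - η * eps2 G L α β) * blockForm (centering n) x
        + η * (eps3 G α β - η * eps4 β) * blockForm (centering n) (dualError f β x v)
        + c * (η * (ν / 2) * subopt f x) := by
  have hn0 : n ≠ 0 := by omega
  have hρ₂ := G.rho2_pos hG hn
  have hρ := hρ₂.trans_le (G.rho2_le_rho hG hn)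
  have hβ := h.beta_pos
  have hαβ := h.beta_lt_alpha hρ₂
  have hη := h.eta_pos
  have hX := blockForm_centering_nonneg hn0 x
  have hW := blockForm_centering_nonneg hn0 (dualError f β x v)
  have hF := subopt_nonneg hopt x
  have hr := rate_pos h hL hρ₂ hρ hν
  have h8 := one_lt_eps8 (G := G) hρ₂ hβ hαβ
  have hc0 : 0 ≤ c := by
    by_contra! hneg
    nlinarith
  have h10 := rate_mul_eps8 (ν := ν) h hρ₂
  have b1 : eps10 G L α β η ν ≤ η * (eps1 G L α β - η * eps2 G L α β) :=
    mul_le_mul_of_nonneg_left ((min_le_left _ _).trans (min_le_left _ _)) hη.le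
  have b2 : eps10 G L α β η ν ≤ η * (eps3 G α β - η * eps4 β) :=
    mul_le_mul_of_nonneg_left ((min_le_left _ _).trans (min_le_right _ _)) hη.le
  have b3 : eps10 G L α β η ν ≤ η * (ν / 2) :=
    mul_le_mul_of_nonneg_left (min_le_right _ _) hη.le
  have e1 := mul_le_mul_of_nonneg_left (energy_le G hG hn hβ hαβ x (dualError f β x v)) hr.le
  rw [← mul_assoc, h10] at e1
  have e2 : rate G L α β η ν * μ ≤ c * eps10 G L α β η ν := by
    rw [← h10]
    linarith [mul_le_mul_of_nonneg_left hc hr.le]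
  have e3 := mul_le_mul_of_nonneg_right e2 hF
  have e4 := mul_le_mul_of_nonneg_right b1 hX
  have e5 := mul_le_mul_of_nonneg_right b2 hW
  have e6 := mul_le_mul_of_nonneg_left (mul_le_mul_of_nonneg_right b3 hF) hc0
  linarith

theorem subopt_le (hPL : PolyakLojasiewicz (globalCost f) ν) (x : Stacked n p) :
    ν * subopt f x ≤ 1 / 2 * (n * ‖gradient (globalCost f) (average x)‖ ^ 2) := by
  have h := mul_le_mul_of_nonneg_left (hPL.2 (average x)) (Nat.cast_nonneg (α := ℝ) n)
  rw [subopt]; linarith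

/-- Decay of `E + F`. Young's inequality with `θ = 1` leaves the square `(1 - L)²` on the
disagreement. -/
theorem IsPrimalDualRun.lyapunov_step (hrun : IsPrimalDualRun G f α β η x v)
    (h : Admissible G L κ₂ α β η) (hG : G.Connected) (hn : 2 ≤ n)
    (hf : ∀ i, SmoothWith (f i) L) (hopt : (optimalSet (globalCost f)).Nonempty)
    (hPL : PolyakLojasiewicz (globalCost f) ν) (k : ℕ) :
    energy G (α / β) (x (k + 1)) (dualError f β (x (k + 1)) (v (k + 1))) + subopt f (x (k + 1)) ≤
      (1 - rate G L α β η ν) *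
        (energy G (α / β) (x k) (dualError f β (x k) (v k)) + subopt f (x k)) := by
  have hn0 : n ≠ 0 := by omega
  have hL : 0 < L := (hf ⟨0, by omega⟩).1
  have hρ₂ := G.rho2_pos hG hn
  have hβ := h.beta_pos
  have hαβ := h.beta_lt_alpha hρ₂
  have hη := h.eta_pos
  have hE := hrun.energy_step_le hn hG hf hL hβ hαβ hη one_pos k
  have hF := hrun.subopt_step_le hn0 hf k
  have hR := rate_mul_le h hG hn hL hPL.1 hopt zero_le_one (c := 1)
    (by linarith [one_lt_eps8 (G := G) hρ₂ hβ hαβ]) (x k) (v k)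
  have hP := mul_le_mul_of_nonneg_left (subopt_le hPL (x k)) hη.le
  have h56 := (h.eps56_pos hL hρ₂).le
  have he := norm_meanGradient_sub_sq_le hn0 hf (x k)
  have hX := blockForm_centering_nonneg hn0 (x k)
  set g := meanGradient f (x k)
  set u := gradient (globalCost f) (average (x k))
  rw [norm_sub_sq_real] at he
  have he' := mul_le_mul_of_nonneg_left he hη.le
  have hG2 : 0 ≤ (n : ℝ) * ‖g‖ ^ 2 := by positivity
  have hU2 : 0 ≤ η * ((n : ℝ) * ‖u‖ ^ 2) := by positivity
  have e1 : L ^ 2 / (2 * 1 * β ^ 2) + (1 / G.rho2 + α / β) * L ^ 2 / (2 * β) =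
      1 / 4 - eps5 G L α β := by
    rw [eps5]; field_simp; ring
  rw [e1] at hE
  have q1 : 0 ≤ η * ((1 - L) ^ 2 * blockForm (centering n) (x k)) := by positivity
  have q2 := mul_nonneg hη.le (mul_nonneg h56 hG2)
  have q3 := mul_nonneg hη.le hG2
  linear_combination hE + hF + hR + 1 / 2 * he' + 1 / 2 * q1 + q2 + 1 / 4 * q3 + 1 / 2 * hP
    + 1 / 4 * hU2

/-- The inexact gradient step inequality behind the decay of `E + 2 F`: a quadratic form in the
gradient `u` and the error `g - u`, maximized over `u`. -/
theorem neg_two_inner_le {E : Type*} [NormedAddCommGroup E] [InnerProductSpace ℝ E] {q A : ℝ}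
    (hA : 0 < 2 - q - A) (g u : E) :
    -2 * inner ℝ g u ≤ -A * ‖g‖ ^ 2 - q * ‖u‖ ^ 2 + (1 - q * A) / (2 - q - A) * ‖g - u‖ ^ 2 := by
  have h : 0 ≤ 1 / (2 - q - A) * ‖(2 - q - A) • u + (1 - A) • (g - u)‖ ^ 2 := by positivity
  have e : -A * ‖g‖ ^ 2 - q * ‖u‖ ^ 2 + (1 - q * A) / (2 - q - A) * ‖g - u‖ ^ 2
      - (-2 * inner ℝ g u) = 1 / (2 - q - A) * ‖(2 - q - A) • u + (1 - A) • (g - u)‖ ^ 2 := by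
    have e1 := real_inner_comm g u
    simp only [← real_inner_self_eq_norm_sq, inner_add_left, inner_add_right, inner_sub_left,
      inner_sub_right, real_inner_smul_left, real_inner_smul_right, e1]
    field_simp
    ring
  linarith

/-- The numerical fact behind the decay of `E + 2 F`: with `A = 1 / 4 + 3 s² / 2 + s / 4` and
`q = 2 / 7`, it says `L² (1 - q A) / (2 - q - A) ≤ 7 / 8 - L + L²`, where `A` bounds the coefficient
of the squared mean gradient. -/
theorem young_margin {L s : ℝ} (hL : 0 < L) (hs : 0 < s)
    (hsL : s ^ 2 + 2 * L * s ≤ 1 / 2) :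
    1 / 4 + 3 / 2 * s ^ 2 + s / 4 < 6 / 5 ∧
    L ^ 2 * (7 - 2 * (1 / 4 + 3 / 2 * s ^ 2 + s / 4)) ≤
      (7 / 8 - L + L ^ 2) * (12 - 7 * (1 / 4 + 3 / 2 * s ^ 2 + s / 4)) := by
  have hLs : 0 < L * s := mul_pos hL hs
  have hs1 : s < 71 / 100 := by nlinarith
  have hB : 5 / 8 ≤ 7 / 8 - L + L ^ 2 := by nlinarith [sq_nonneg (L - 1 / 2)]
  refine ⟨by nlinarith, ?_⟩
  have hl : L ^ 2 * (7 - 2 * (1 / 4 + 3 / 2 * s ^ 2 + s / 4)) ≤ L ^ 2 * (13 / 2) := by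
    gcongr; nlinarith
  refine hl.trans ?_
  -- The bound on `s` improves with `L`; three ranges of `L` suffice.
  rcases le_total L (3 / 5) with h1 | h1
  · have hA : 37 / 10 ≤ 12 - 7 * (1 / 4 + 3 / 2 * s ^ 2 + s / 4) := by nlinarith
    have : L ^ 2 * (13 / 2) ≤ (7 / 8 - L + L ^ 2) * (37 / 10) := by nlinarith
    exact this.trans (mul_le_mul_of_nonneg_left hA (by linarith))
  rcases le_total L 1 with h2 | h2
  · have hs2 : s ≤ 33 / 100 := by nlinarith
    have hA : 17 / 2 ≤ 12 - 7 * (1 / 4 + 3 / 2 * s ^ 2 + s / 4) := by nlinarith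
    have : L ^ 2 * (13 / 2) ≤ (7 / 8 - L + L ^ 2) * (17 / 2) := by nlinarith
    exact this.trans (mul_le_mul_of_nonneg_left hA (by linarith))
  · have hs2 : s ≤ 9 / 40 := by nlinarith
    have hA : 93 / 10 ≤ 12 - 7 * (1 / 4 + 3 / 2 * s ^ 2 + s / 4) := by nlinarith
    have : L ^ 2 * (13 / 2) ≤ (7 / 8 - L + L ^ 2) * (93 / 10) := by
      nlinarith [sq_nonneg (L - 5 / 3)]
    exact this.trans (mul_le_mul_of_nonneg_left hA (by linarith))

/-- Decay of `E + 2 F` if `ε₉ > 1 / 4`, that is, if `α > 2 β` and `ρ(L) < 2`. Then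
`1 / ρ₂(L) + α / β ≥ 2`, and `ε₅ > 0` bounds `s = L / β` by `s² + 2 L s ≤ 1 / 2`; the choice
`θ = 1 / 4` in Young's inequality then leaves the doubled gradient error affordable. -/
theorem IsPrimalDualRun.lyapunov_two_step (hrun : IsPrimalDualRun G f α β η x v)
    (h : Admissible G L κ₂ α β η) (hG : G.Connected) (hn : 2 ≤ n)
    (hf : ∀ i, SmoothWith (f i) L) (hopt : (optimalSet (globalCost f)).Nonempty)
    (hPL : PolyakLojasiewicz (globalCost f) ν) (h9 : 1 / 4 < eps9 G α β) (k : ℕ) :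
    energy G (α / β) (x (k + 1)) (dualError f β (x (k + 1)) (v (k + 1)))
        + 2 * subopt f (x (k + 1)) ≤
      (1 - rate G L α β η ν) *
        (energy G (α / β) (x k) (dualError f β (x k) (v k)) + 2 * subopt f (x k)) := by
  have hn0 : n ≠ 0 := by omega
  have hL : 0 < L := (hf ⟨0, by omega⟩).1
  have hρ₂ := G.rho2_pos hG hn
  have hρ := G.rho2_le_rho hG hn
  have hρ0 := hρ₂.trans_le hρ
  have hβ := h.beta_pos
  have hαβ := h.beta_lt_alpha hρ₂
  have hα := hβ.trans hαβ
  have hη := h.eta_pos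
  have hr : 2 < α / β := by
    have h1 := h9.trans_le (min_le_right _ _)
    rw [lt_div_iff₀ (by positivity)] at h1
    rw [lt_div_iff₀ hβ]; linarith
  have hρ2 : 1 / 2 < 1 / G.rho2 := by
    have h1 := h9.trans_le (min_le_left _ _)
    rw [lt_div_iff₀ (by positivity)] at h1
    exact one_div_lt_one_div_of_lt hρ₂ (by linarith)
  have h8 : 7 / 4 ≤ eps8 G α β := by
    have e : eps8 G α β = α / β / 2 + 1 / 2 + 1 / G.rho2 / 2 := by rw [eps8]; field_simp
    rw [e]; linarith
  obtain ⟨s, hsdef⟩ : ∃ s, s = L / β := ⟨_, rfl⟩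
  have hs : 0 < s := hsdef ▸ div_pos hL hβ
  have h56 := (h.eps56_pos hL hρ₂).le
  have e5 : eps5 G L α β = 1 / 4 - s ^ 2 / 2 - (1 / G.rho2 + α / β) * L * s / 2 := by
    rw [eps5, hsdef]; field_simp; ring
  have h6 : 0 < eps6 G L α β := by rw [eps6]; positivity
  have hsL : s ^ 2 + 2 * L * s ≤ 1 / 2 := by
    have h1 : 0 < η * eps6 G L α β := mul_pos hη h6
    have h2 : 2 * (L * s) ≤ (1 / G.rho2 + α / β) * (L * s) :=
      mul_le_mul_of_nonneg_right (by linarith) (by positivity)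
    linarith
  have hηL : η * L ≤ s / 2 := by
    have h1 := mul_le_mul_of_nonneg_right (h.eta_mul_beta_le hρ₂) hs.le
    have h2 : β * s = L := by rw [hsdef]; field_simp
    rw [mul_assoc, h2] at h1
    linarith
  obtain ⟨hA1, hA2⟩ := young_margin hL hs hsL
  obtain ⟨A, hA⟩ : ∃ A, A = 1 / 4 + 3 / 2 * s ^ 2 + s / 4 := ⟨_, rfl⟩
  rw [← hA] at hA1 hA2
  have hE := hrun.energy_step_le hn hG hf hL hβ hαβ hη (θ := 1 / 4) (by norm_num) k
  have hF := hrun.subopt_step_le hn0 hf k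
  have hR := rate_mul_le h hG hn hL hPL.1 hopt zero_le_two (c := 8 / 7) (by linarith) (x k) (v k)
  have hP := mul_le_mul_of_nonneg_left (subopt_le hPL (x k)) hη.le
  have he := norm_meanGradient_sub_sq_le hn0 hf (x k)
  have hX := blockForm_centering_nonneg hn0 (x k)
  set g := meanGradient f (x k)
  set u := gradient (globalCost f) (average (x k))
  have hG2 : 0 ≤ (n : ℝ) * ‖g‖ ^ 2 := by positivity
  have hI := mul_le_mul_of_nonneg_left
    (neg_two_inner_le (q := 2 / 7) (A := A) (by linarith) g u) (Nat.cast_nonneg (α := ℝ) n)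
  have hB : (1 - 2 / 7 * A) / (2 - 2 / 7 - A) * (n * ‖g - u‖ ^ 2) ≤
      (7 / 8 - L + L ^ 2) * blockForm (centering n) (x k) := by
    have hD : 0 < 2 - 2 / 7 - A := by linarith
    have hN : 0 ≤ (1 - 2 / 7 * A) / (2 - 2 / 7 - A) := div_nonneg (by linarith) hD.le
    calc _ ≤ (1 - 2 / 7 * A) / (2 - 2 / 7 - A) * (L ^ 2 * blockForm (centering n) (x k)) :=
          mul_le_mul_of_nonneg_left he hN
      _ = ((1 - 2 / 7 * A) / (2 - 2 / 7 - A) * L ^ 2) * blockForm (centering n) (x k) := by ring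
      _ ≤ _ := by
        refine mul_le_mul_of_nonneg_right ?_ hX
        rw [div_mul_eq_mul_div, div_le_iff₀ hD]
        linarith
  have hI' := mul_le_mul_of_nonneg_left (hI.trans (by
    linarith [hB] : _ ≤ -A * (n * ‖g‖ ^ 2) - 2 / 7 * (n * ‖u‖ ^ 2)
      + (7 / 8 - L + L ^ 2) * blockForm (centering n) (x k))) hη.le
  have e1 : L ^ 2 / (2 * (1 / 4) * β ^ 2) + (1 / G.rho2 + α / β) * L ^ 2 / (2 * β) =
      2 * s ^ 2 + (1 / G.rho2 + α / β) * L * s / 2 := by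
    rw [hsdef]; field_simp; ring
  rw [e1] at hE
  rw [e5] at h56
  have hC : 2 * s ^ 2 + (1 / G.rho2 + α / β) * L * s / 2 + η * (eps6 G L α β - L / 2) + η * L
      ≤ A := by rw [hA]; linarith
  have q1 := mul_le_mul_of_nonneg_left (mul_le_mul_of_nonneg_right hC hG2) hη.le
  linear_combination hE + 2 * hF + hR + hI' + q1 + 4 / 7 * hP

theorem le_pow_mul_of_step {u : ℕ → ℝ} {r : ℝ} (hr : 0 ≤ r) (h : ∀ k, u (k + 1) ≤ r * u k)
    (k : ℕ) : u k ≤ r ^ k * u 0 := by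
  induction k with
  | zero => simp
  | succ k ih =>
    calc u (k + 1) ≤ r * u k := h k
      _ ≤ r * (r ^ k * u 0) := mul_le_mul_of_nonneg_left ih hr
      _ = r ^ (k + 1) * u 0 := by ring

end Decay

end DistOpt

theorem theorem2 (n p : ℕ) (hn : 2 ≤ n)
    (G : DistOpt.WeightedGraph n) (hG : G.Connected)
    (f : Fin n → DistOpt.Vec p → ℝ)
    (hopt : (DistOpt.optimalSet (DistOpt.globalCost f)).Nonempty)
    (Lf : ℝ) (hsmooth : ∀ i, DistOpt.SmoothWith (f i) Lf)
    (κ₂ α β η : ℝ) (hpar : DistOpt.Admissible G Lf κ₂ α β η)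
    (x v : ℕ → DistOpt.Stacked n p) (hrun : DistOpt.IsPrimalDualRun G f α β η x v)
    (ν : ℝ) (hPL : DistOpt.PolyakLojasiewicz (DistOpt.globalCost f) ν) :
    (0 < DistOpt.rate G Lf α β η ν ∧ DistOpt.rate G Lf α β η ν < 1) ∧
    (∀ k : ℕ,
      ‖x k - DistOpt.consensus n (DistOpt.average (x k))‖ ^ 2 +
          n * (DistOpt.globalCost f (DistOpt.average (x k)) -
            DistOpt.optimalValue (DistOpt.globalCost f)) ≤
        (1 - DistOpt.rate G Lf α β η ν) ^ k * DistOpt.initConst G f α β (x 0) (v 0)) ∧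
    (∀ P : DistOpt.Vec p → DistOpt.Vec p,
      DistOpt.IsProjectionOnto (DistOpt.optimalSet (DistOpt.globalCost f)) P →
      ∀ k : ℕ,
        ‖x k - DistOpt.consensus n (P (DistOpt.average (x k)))‖ ^ 2 ≤
          (1 - DistOpt.rate G Lf α β η ν) ^ k * DistOpt.initConst G f α β (x 0) (v 0) *
            (1 + 1 / (2 * ν))) := by
  have hn0 : n ≠ 0 := by omega
  have hL : 0 < Lf := (hsmooth ⟨0, by omega⟩).1
  have hν := hPL.1
  have hρ₂ := G.rho2_pos hG hn
  have hρ := G.rho2_le_rho hG hn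
  have hβ := hpar.beta_pos
  have hαβ := hpar.beta_lt_alpha hρ₂
  have hr0 := DistOpt.rate_pos hpar hL hρ₂ (hρ₂.trans_le hρ) hν
  have hr1 := DistOpt.rate_lt_one (ν := ν) hpar hρ₂ hρ
  have h8 := DistOpt.one_lt_eps8 (G := G) hρ₂ hβ hαβ
  have h9 := DistOpt.eps9_pos (G := G) (hρ₂.trans_le hρ) hβ hαβ
  have h9' := DistOpt.eps9_le_half (G := G) hβ hαβ
  have hX := fun z : DistOpt.Stacked n p => DistOpt.blockForm_centering_nonneg hn0 z
  have hF := DistOpt.subopt_nonneg (n := n) hopt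
  have hEl := fun k => DistOpt.le_energy G hG hn hβ hαβ (x k) (DistOpt.dualError f β (x k) (v k))
  have hEu := DistOpt.energy_le G hG hn hβ hαβ (x 0) (DistOpt.dualError f β (x 0) (v 0))
  have hr : 0 ≤ 1 - DistOpt.rate G Lf α β η ν := by linarith
  have hpow : ∀ k, 0 ≤ (1 - DistOpt.rate G Lf α β η ν) ^ k := fun k =>
    pow_nonneg hr k
  have hV0 := DistOpt.lyapHat_eq f β (x 0) (v 0)
  obtain ⟨S, hS⟩ : ∃ S : ℕ → ℝ, ∀ k, S k = (1 - DistOpt.rate G Lf α β η ν) ^ k *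
    (DistOpt.eps8 G α β * DistOpt.lyapHat f β (x 0) (v 0)) := ⟨_, fun _ => rfl⟩
  have hC : ∀ k, (1 - DistOpt.rate G Lf α β η ν) ^ k * DistOpt.initConst G f α β (x 0) (v 0) =
      S k / DistOpt.eps9 G α β := fun k => by
    rw [hS, DistOpt.initConst, mul_div_assoc']
  have key : ∀ k, DistOpt.energy G (α / β) (x k) (DistOpt.dualError f β (x k) (v k))
      + DistOpt.subopt f (x k) ≤ S k := by
    intro k
    refine (DistOpt.le_pow_mul_of_step (u := fun k => DistOpt.energy G (α / β) (x k)
      (DistOpt.dualError f β (x k) (v k)) + DistOpt.subopt f (x k)) hr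
      (hrun.lyapunov_step hpar hG hn hsmooth hopt hPL) k).trans ?_
    rw [hS]
    refine mul_le_mul_of_nonneg_left ?_ (hpow k)
    rw [hV0]
    nlinarith [hF (x 0)]
  have first : ∀ k, DistOpt.blockForm (DistOpt.centering n) (x k) + DistOpt.subopt f (x k) ≤
      S k / DistOpt.eps9 G α β := by
    intro k
    rw [le_div_iff₀ h9]
    nlinarith [key k, hEl k, hX (DistOpt.dualError f β (x k) (v k)), hF (x k)]
  -- Quadratic growth alone gives the factor `2 / ν`; with `n (f(x̄) - f*) ≤ (1 - ε)^k c / 4` it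
  -- becomes `1 / (2 ν)`.
  have quarter : ∀ k, 4 * DistOpt.subopt f (x k) ≤ S k / DistOpt.eps9 G α β := by
    intro k
    rw [le_div_iff₀ h9]
    rcases le_or_gt (DistOpt.eps9 G α β) (1 / 4) with hle | hgt
    · nlinarith [key k, hEl k, hX (DistOpt.dualError f β (x k) (v k)), hX (x k), hF (x k)]
    · have h49 := DistOpt.four_mul_eps9_le_eps8 (G := G) hρ₂ hβ hαβ
      have h1 := DistOpt.le_pow_mul_of_step (u := fun k => DistOpt.energy G (α / β) (x k)
        (DistOpt.dualError f β (x k) (v k)) + 2 * DistOpt.subopt f (x k)) hr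
        (hrun.lyapunov_two_step hpar hG hn hsmooth hopt hPL hgt) k
      have h2 : 2 * DistOpt.eps9 G α β *
          (DistOpt.energy G (α / β) (x 0) (DistOpt.dualError f β (x 0) (v 0))
            + 2 * DistOpt.subopt f (x 0)) ≤
          DistOpt.eps8 G α β * DistOpt.lyapHat f β (x 0) (v 0) := by
        have a1 := mul_le_mul_of_nonneg_left hEu (by linarith : 0 ≤ 2 * DistOpt.eps9 G α β)
        have a2 := mul_le_mul_of_nonneg_right h49 (hF (x 0))
        have a3 : 0 ≤ DistOpt.eps8 G α β * (DistOpt.blockForm (DistOpt.centering n) (x 0)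
            + DistOpt.blockForm (DistOpt.centering n) (DistOpt.dualError f β (x 0) (v 0))) :=
          mul_nonneg (by linarith) (add_nonneg (hX _) (hX _))
        have a4 := mul_le_mul_of_nonneg_right (by linarith : 2 * DistOpt.eps9 G α β ≤ 1) a3
        rw [hV0]
        linarith
      have h3 := mul_le_mul_of_nonneg_left h2 (hpow k)
      rw [← hS] at h3
      have h4 := mul_le_mul_of_nonneg_left h1 (by linarith : 0 ≤ 2 * DistOpt.eps9 G α β)
      have h5 : 0 ≤ DistOpt.energy G (α / β) (x k) (DistOpt.dualError f β (x k) (v k)) :=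
        (mul_nonneg h9.le (add_nonneg (hX _) (hX _))).trans (hEl k)
      have h6 := mul_nonneg h9.le h5
      linarith
  refine ⟨⟨hr0, hr1⟩, fun k => ?_, fun P hP k => ?_⟩
  · rw [hC, DistOpt.norm_sub_consensus_sq, ← DistOpt.blockForm_centering hn0]
    exact first k
  · rw [hC, DistOpt.norm_sub_consensus_sq, DistOpt.sum_norm_sub_sq hn0,
      ← DistOpt.blockForm_centering hn0]
    have hsm := DistOpt.SmoothWith.globalCost hn0 hsmooth
    have hq := mul_le_mul_of_nonneg_left
      (hPL.quadratic_growth hsm.2.1 hopt hP (DistOpt.average (x k))) (Nat.cast_nonneg (α := ℝ) n)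
    rw [← DistOpt.subopt] at hq
    have hD : n * ‖DistOpt.average (x k) - P (DistOpt.average (x k))‖ ^ 2 ≤
        S k / DistOpt.eps9 G α β * (1 / (2 * ν)) := by
      rw [mul_one_div, le_div_iff₀ (by positivity)]
      linarith [quarter k]
    linarith [first k, hF (x k)]
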